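/- Let $M\ge 2$, $p\ge 1$, $L\ge 1$ and $m\ge 0$ be integers. For a function $f:\mathbb R\to\mathbb R^p$, call $t\in\mathbb R$ a breakpoint of $f$ if $f$ does not coincide with an affine function on any neighbourhood of $t$; call $f$ CPwL if it is continuous and has finitely many breakpoints in every compact interval. For a family of real $p\times p$ matrices $(A_j)_{j\in\mathbb Z}$ with $A_j=0$ for all but finitely many $j$, let $$(V\gamma)(t)=\sum_{j\in\mathbb Z}A_j\,\gamma(Mt-j),\qquad \gamma:\mathbb R\to\mathbb R^p,\ t\in\mathbb R,$$ and say that $V$ preserves the window $[0,L]$ if $\operatorname{supp}(V\gamma)\subset[0,L]$ for every compactly supported CPwL curve $\gamma:\mathbb R\to\mathbb R^p$ with $\operatorname{supp}\gamma\subset[0,L]$. A ReLU network of width $W$ and depth $D$ is a fully connected feed-forward network with $D$ hidden layers of $W$ neurons each, the activation $u\mapsto\max(u,0)$ being applied componentwise in every hidden layer, followed by an affine output layer. Then there exist positive integers $C_0,C_1$, depending only on $M,p,L,m$, such that the following holds. Let $(A_j)$ be as above with $V$ preserving the window $[0,L]$, and let $\gamma:\mathbb R\to\mathbb R^p$ be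 a compactly supported CPwL curve with $\operatorname{supp}\gamma\subset[0,L]$ and at most $m$ breakpoints. Then there are constants $C_2,\Lambda>0$ (which may depend on $M,p,L,m$, $\gamma$ and $(A_j)$, but not on $n$) such that for every integer $n\ge 1$ there is a ReLU network with input dimension $1$, output dimension $p$, width $C_0$ and depth $C_1n$, all of whose weights and biases are at most $C_2\Lambda^n$ in absolute value, and whose output equals $V^n\gamma(t)$ for every $t\in\mathbb R$. -/

import Mathlib

open Set Filter Topology

/-! ### Continuous piecewise linear curves -/

/-- The breakpoints of `f : ℝ → ℝ^p`: the points near which `f` does not agree with an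
affine map `s ↦ b + s • a`. -/
def breakpoints {p : ℕ} (f : ℝ → Fin p → ℝ) : Set ℝ :=
  {t | ¬ ∃ a b : Fin p → ℝ, ∀ᶠ s in 𝓝 t, f s = b + s • a}

/-- Continuous and piecewise affine, with finitely many breakpoints on every compact interval. -/
structure IsCPwL {p : ℕ} (f : ℝ → Fin p → ℝ) : Prop where
  continuous : Continuous f
  finite_breakpoints : ∀ a b : ℝ, (breakpoints f ∩ Icc a b).Finite

/-! ### The homogeneous refinement operator -/

/-- `(V γ)(t) = ∑ j, A j * γ (M t - j)`, for a finitely supported family of matrices `A`. -/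
noncomputable def refine (M : ℕ) {p : ℕ} (A : ℤ →₀ Matrix (Fin p) (Fin p) ℝ)
    (γ : ℝ → Fin p → ℝ) : ℝ → Fin p → ℝ :=
  fun t => A.sum fun j B => B.mulVec (γ ((M : ℝ) * t - (j : ℝ)))

/-- The operator with data `M`, `A` maps every CPwL curve with (closed) support in `[0, L]` to a
curve with support in `[0, L]`. -/
def PreservesWindow (M L : ℕ) {p : ℕ} (A : ℤ →₀ Matrix (Fin p) (Fin p) ℝ) : Prop :=
  ∀ γ : ℝ → Fin p → ℝ, IsCPwL γ → HasCompactSupport γ → tsupport γ ⊆ Icc 0 (L : ℝ) →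
    tsupport (refine M A γ) ⊆ Icc 0 (L : ℝ)

/-! ### Fully connected ReLU networks -/

/-- `ReLUNet W N d D` is the type of fully connected feed-forward networks with input dimension
`d`, output dimension `N`, and `D` hidden layers, each of them with exactly `W` neurons.
Every layer carries a weight matrix and a bias vector; the last one has no activation. -/
inductive ReLUNet (W N : ℕ) : ℕ → ℕ → Type
  | output {d : ℕ} (weight : Matrix (Fin N) (Fin d) ℝ) (bias : Fin N → ℝ) : ReLUNet W N d 0
  | hidden {d D : ℕ} (weight : Matrix (Fin W) (Fin d) ℝ) (bias : Fin W → ℝ)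
      (next : ReLUNet W N W D) : ReLUNet W N d (D + 1)

/-- The function computed by a network: affine maps, with the componentwise activation
`u ↦ max u 0` after every hidden layer. -/
noncomputable def ReLUNet.realize {W N : ℕ} :
    {d D : ℕ} → ReLUNet W N d D → (Fin d → ℝ) → Fin N → ℝ
  | _, _, .output weight bias, x => weight.mulVec x + bias
  | _, _, .hidden weight bias next, x =>
      next.realize fun i => max ((weight.mulVec x + bias) i) 0

/-- All weights and biases of the network are at most `B` in absolute value. -/
def ReLUNet.BoundedBy {W N : ℕ} (B : ℝ) : {d D : ℕ} → ReLUNet W N d D → Prop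
  | _, _, .output weight bias => (∀ i j, |weight i j| ≤ B) ∧ ∀ i, |bias i| ≤ B
  | _, _, .hidden weight bias next =>
      (∀ i j, |weight i j| ≤ B) ∧ (∀ i, |bias i| ≤ B) ∧ next.BoundedBy B

/-!
A hat `η` shorter than `1`, moved into the interior of `[0, 1]`, gives rise to a curve `V ^ n (η v)`
that on the cell of `t` in the grid `M⁻ⁿ ℤ` is `η (frac (M ^ n t))` times a vector; this vector is
a product of `n` matrices selected by the base-`M` digits of `t`. A network of bounded width can
carry a row vector `w` along and multiply it from the right by one matrix per digit. Three
obstacles have to be overcome.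

* Real numbers cannot be multiplied by a ReLU network, but the last factor `η (x)` has to be. Hence
  the network carries `w x` next to `w` and the current position `x`. As `x` becomes `M x - d`, the
  moment `w x` is updated linearly, once the digit `d` is known, and `w η(x)` is piecewise linear in
  `w`, `w x` and `x` (`hatReadout_eq`).
* Digits are discontinuous. They are replaced by gates, which close near the multiples of `1 / M`
  and set the weights to `0` there. This is harmless: `η` vanishes near the integers, so the curve
  vanishes near the whole grid `M⁻ⁿ ℤ`, and exponentially steep gates close only there. The gates
  for the position open before those for the weights, so that half open weight gates occur only
  with exact positions. `State.out_iterate` makes this precise, with the invariant `State.Valid`. The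
  gain of the gates has to dominate the weights, which grow exponentially, as the gates only work
  exactly for bounded inputs (`gate_of_one_le`, `gate_of_le_neg_one`).
* The mask `A` must be bounded in length by `M` and `L`. This is what preserving the window gives
  (`PreservesWindow.mask_eq_zero`). The curve on `[0, L]` is then a vector of `L` blocks on
  `[0, 1]`, refined by `M` matrices (`iterate_refine_eq_sum_cell`).

A curve with `m` breakpoints in `[0, L]` is a sum of at most `m + 4 L` hats of length at most
`1 / 2` (`exists_eq_sum_hat`), and moving a hat by `θ` moves its `n`-th refinement by `θ / M ^ n`
(`iterate_refine_comp_sub`), so finitely many such networks in parallel compute `V ^ n γ`.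

Networks are handled through the finite sets of signals, as functions of the input `t`, that the
neurons of a layer carry (`Layers`, `Comp`). Bounds on weights and on affine readouts are kept
apart, so that composing `n` blocks of layers does not multiply their bounds (`CompAll.comp`).
-/

/-! ### Affine combinations and layers of functions -/

/-- `u` is an affine combination of the functions in `S`, with all coefficients and the constant
term at most `C` in absolute value. -/
def AffComb (C : ℝ) (S : Finset (ℝ → ℝ)) (u : ℝ → ℝ) : Prop :=
  ∃ (a : (ℝ → ℝ) → ℝ) (b : ℝ), (∀ h, |a h| ≤ C) ∧ |b| ≤ C ∧ ∀ t, u t = ∑ h ∈ S, a h * h t + b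

namespace AffComb

variable {C C' : ℝ} {S S' V : Finset (ℝ → ℝ)} {u v : ℝ → ℝ}

lemma nonneg (h : AffComb C S u) : 0 ≤ C := by
  obtain ⟨a, b, _, hb, _⟩ := h
  exact (abs_nonneg b).trans hb

lemma mono (h : AffComb C S u) (hC : C ≤ C') : AffComb C' S u := by
  obtain ⟨a, b, ha, hb, hu⟩ := h
  exact ⟨a, b, fun x => (ha x).trans hC, hb.trans hC, hu⟩

lemma subset (h : AffComb C S u) (hS : S ⊆ S') : AffComb C S' u := by
  classical
  have hC := h.nonneg
  obtain ⟨a, b, ha, hb, hu⟩ := h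
  refine ⟨fun x => if x ∈ S then a x else 0, b, fun x => ?_, hb, fun t => ?_⟩
  · dsimp only
    split_ifs
    · exact ha x
    · simpa using hC
  · rw [hu t]
    congr 1
    rw [← Finset.sum_subset hS]
    · exact Finset.sum_congr rfl fun x hx => by simp [hx]
    · intro x _ hx
      simp [hx]

lemma const {c : ℝ} (hc : |c| ≤ C) : AffComb C S fun _ => c :=
  ⟨fun _ => 0, c, fun _ => by simpa using (abs_nonneg c).trans hc, hc, fun t => by simp⟩

lemma of_mem (h : u ∈ S) : AffComb 1 S u := by
  classical
  refine ⟨fun x => if x = u then 1 else 0, 0, fun x => ?_, by simp, fun t => ?_⟩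
  · dsimp only
    split_ifs <;> simp
  · simp [ite_mul, Finset.sum_ite_eq', h]

lemma add (hu : AffComb C S u) (hv : AffComb C' S v) :
    AffComb (C + C') S fun t => u t + v t := by
  obtain ⟨a, b, ha, hb, hu⟩ := hu
  obtain ⟨a', b', ha', hb', hv⟩ := hv
  refine ⟨fun x => a x + a' x, b + b', fun x => (abs_add_le _ _).trans (add_le_add (ha x) (ha' x)),
    (abs_add_le _ _).trans (add_le_add hb hb'), fun t => ?_⟩
  simp only [hu t, hv t, add_mul, Finset.sum_add_distrib]
  ring

lemma smul (hu : AffComb C S u) (c : ℝ) : AffComb (|c| * C) S fun t => c * u t := by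
  obtain ⟨a, b, ha, hb, hu⟩ := hu
  refine ⟨fun x => c * a x, c * b, fun x => ?_, ?_, fun t => ?_⟩
  · rw [abs_mul]
    exact mul_le_mul_of_nonneg_left (ha x) (abs_nonneg c)
  · rw [abs_mul]
    exact mul_le_mul_of_nonneg_left hb (abs_nonneg c)
  · simp only [hu t, mul_add, Finset.mul_sum, mul_assoc]

lemma trans {B : ℝ} (hV : ∀ v ∈ V, AffComb C S v) (hu : AffComb B V u) :
    AffComb (V.card * (B * C) + B) S u := by
  have hB := hu.nonneg
  obtain ⟨a, b, ha, hb, hu⟩ := hu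
  choose! α β hα hβ hv using hV
  have bound : ∀ f : (ℝ → ℝ) → ℝ, (∀ v ∈ V, |f v| ≤ C) →
      |∑ v ∈ V, a v * f v| ≤ V.card * (B * C) := by
    intro f hf
    refine (Finset.abs_sum_le_sum_abs _ _).trans ?_
    rw [← nsmul_eq_mul]
    refine Finset.sum_le_card_nsmul _ _ _ fun v hv => ?_
    rw [abs_mul]
    exact mul_le_mul (ha v) (hf v hv) (abs_nonneg _) hB
  refine ⟨fun x => ∑ v ∈ V, a v * α v x, ∑ v ∈ V, a v * β v + b, fun x => ?_, ?_, fun t => ?_⟩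
  · have := bound (fun v => α v x) fun v hv => hα v hv x
    linarith
  · exact (abs_add_le _ _).trans (add_le_add (bound β hβ) hb)
  · have : ∀ v ∈ V, a v * v t = ∑ x ∈ S, a v * α v x * x t + a v * β v := by
      intro v hV'
      rw [hv v hV' t, mul_add, Finset.mul_sum]
      simp only [mul_assoc]
    rw [hu t, Finset.sum_congr rfl this, Finset.sum_add_distrib, Finset.sum_comm]
    simp only [Finset.sum_mul]
    ring

end AffComb

/-- `Layers W B D U S`: starting from the input signals `U`, the signals `S` are the outputs of the
neurons in the last of `D` hidden ReLU layers, each with at most `W` neurons, and with weights and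
biases bounded by `B`. All signals are recorded as functions of one real parameter. -/
def Layers (W : ℕ) (B : ℝ) : ℕ → Finset (ℝ → ℝ) → Finset (ℝ → ℝ) → Prop
  | 0, U, S => S = U
  | D + 1, U, S => ∃ S', Layers W B D U S' ∧ S.card ≤ W ∧
      ∀ h ∈ S, ∃ u, AffComb B S' u ∧ h = fun t => max (u t) 0

namespace Layers

variable {W W' D D' : ℕ} {B B' C : ℝ} {U V S S' : Finset (ℝ → ℝ)}

lemma mono (h : Layers W B D U S) (hW : W ≤ W') (hB : B ≤ B') : Layers W' B' D U S := by
  induction D generalizing S with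
  | zero => exact h
  | succ D ih =>
    obtain ⟨S', h1, h2, h3⟩ := h
    refine ⟨S', ih h1, h2.trans hW, fun x hx => ?_⟩
    obtain ⟨u, hu, hx⟩ := h3 x hx
    exact ⟨u, hu.mono hB, hx⟩

lemma append (h : Layers W B D U S) (h' : Layers W B D' S S') : Layers W B (D + D') U S' := by
  induction D' generalizing S' with
  | zero => exact (show S' = S from h') ▸ h
  | succ D' ih =>
    obtain ⟨S'', h1, h2⟩ := h'
    exact ⟨S'', ih h1, h2⟩

open scoped Classical in
lemma union (h : Layers W B D U S) (h' : Layers W' B D U S') :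
    Layers (W + W') B D U (S ∪ S') := by
  induction D generalizing S S' with
  | zero =>
    obtain rfl : S = U := h
    obtain rfl : S' = S := h'
    exact Finset.union_self _
  | succ D ih =>
    obtain ⟨R, h1, h2, h3⟩ := h
    obtain ⟨R', h1', h2', h3'⟩ := h'
    refine ⟨R ∪ R', ih h1 h1', (Finset.card_union_le _ _).trans (add_le_add h2 h2'), ?_⟩
    intro x hx
    rcases Finset.mem_union.1 hx with hx | hx
    · obtain ⟨u, hu, hx⟩ := h3 x hx
      exact ⟨u, hu.subset Finset.subset_union_left, hx⟩
    · obtain ⟨u, hu, hx⟩ := h3' x hx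
      exact ⟨u, hu.subset Finset.subset_union_right, hx⟩

/-- Merging the affine maps between two blocks of layers: the signals `V` need not be neurons. -/
lemma rebase (h : Layers W B (D + 1) V S) (hV : ∀ v ∈ V, AffComb C U v) (hC : 0 ≤ C)
    (hB : 0 ≤ B) : Layers W (V.card * (B * C) + B) (D + 1) U S := by
  have hle : B ≤ V.card * (B * C) + B := by
    have : 0 ≤ (V.card : ℝ) * (B * C) := by positivity
    linarith
  induction D generalizing S with
  | zero =>
    obtain ⟨S', rfl, h2, h3⟩ := h
    refine ⟨U, rfl, h2, fun x hx => ?_⟩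
    obtain ⟨u, hu, hx⟩ := h3 x hx
    exact ⟨u, AffComb.trans hV hu, hx⟩
  | succ D ih =>
    obtain ⟨S', h1, h2, h3⟩ := h
    refine ⟨S', ih h1, h2, fun x hx => ?_⟩
    obtain ⟨u, hu, hx⟩ := h3 x hx
    exact ⟨u, hu.mono hle, hx⟩

/-- Hidden layers carry nonnegative signals, so a layer can be repeated by an identity layer. -/
lemma pad (h : Layers W B (D + 1) U S) (hB : 1 ≤ B) (k : ℕ) : Layers W B (D + k + 1) U S := by
  induction k with
  | zero => exact h
  | succ k ih =>
    have ih' := ih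
    obtain ⟨S', _, h2, h3⟩ := ih'
    refine ⟨S, ih, h2, fun x hx => ⟨x, (AffComb.of_mem hx).mono hB, ?_⟩⟩
    obtain ⟨u, -, rfl⟩ := h3 x hx
    funext t
    simp

lemma empty (hD : 0 < D) : Layers W B D U ∅ := by
  induction D with
  | zero => omega
  | succ D ih =>
    rcases Nat.eq_zero_or_pos D with rfl | hD'
    · exact ⟨U, rfl, by simp, by simp⟩
    · exact ⟨∅, ih hD', by simp, by simp⟩

end Layers

/-! ### Scalar signals computed by layers -/

/-- The signal `u` is an affine readout, with coefficients bounded by `C`, of `D` hidden layers of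
at most `W` neurons with weights bounded by `B` on top of the input signals `U`. -/
def Comp (U : Finset (ℝ → ℝ)) (W D : ℕ) (B C : ℝ) (u : ℝ → ℝ) : Prop :=
  ∃ S, Layers W B D U S ∧ AffComb C S u

/-- The signals `V` are affine readouts of the same hidden layers; see `Comp`. -/
def CompAll (U : Finset (ℝ → ℝ)) (W D : ℕ) (B C : ℝ) (V : Finset (ℝ → ℝ)) : Prop :=
  ∃ S, Layers W B D U S ∧ ∀ v ∈ V, AffComb C S v

namespace Comp

variable {U V : Finset (ℝ → ℝ)} {W W' D D' : ℕ} {B B' C C' : ℝ} {u v : ℝ → ℝ}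

lemma mono (h : Comp U W D B C u) (hW : W ≤ W') (hB : B ≤ B') (hC : C ≤ C') :
    Comp U W' D B' C' u := by
  obtain ⟨S, h1, h2⟩ := h
  exact ⟨S, h1.mono hW hB, h2.mono hC⟩

lemma affine (h : AffComb C U u) : Comp U W 0 B C u := ⟨U, rfl, h⟩

lemma const (U : Finset (ℝ → ℝ)) (W D : ℕ) (B : ℝ) (c : ℝ) : Comp U W D B |c| fun _ => c := by
  rcases Nat.eq_zero_or_pos D with rfl | hD
  · exact ⟨U, rfl, AffComb.const le_rfl⟩
  · exact ⟨∅, Layers.empty hD, AffComb.const le_rfl⟩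

lemma add (hu : Comp U W D B C u) (hv : Comp U W' D B C' v) :
    Comp U (W + W') D B (C + C') fun t => u t + v t := by
  classical
  obtain ⟨S, h1, h2⟩ := hu
  obtain ⟨S', h1', h2'⟩ := hv
  exact ⟨S ∪ S', h1.union h1',
    (h2.subset Finset.subset_union_left).add (h2'.subset Finset.subset_union_right)⟩

lemma smul (hu : Comp U W D B C u) (c : ℝ) : Comp U W D B (|c| * C) fun t => c * u t := by
  obtain ⟨S, h1, h2⟩ := hu
  exact ⟨S, h1, h2.smul c⟩

lemma neg (hu : Comp U W D B C u) : Comp U W D B C fun t => -u t := by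
  simpa using hu.smul (-1)

lemma sub (hu : Comp U W D B C u) (hv : Comp U W' D B C' v) :
    Comp U (W + W') D B (C + C') fun t => u t - v t := by
  simpa only [sub_eq_add_neg] using hu.add hv.neg

lemma sum {ι : Type*} (s : Finset ι) {f : ι → ℝ → ℝ}
    (h : ∀ i ∈ s, Comp U W D B C (f i)) :
    Comp U (s.card * W) D B (s.card * C) fun t => ∑ i ∈ s, f i t := by
  classical
  induction s using Finset.induction_on with
  | empty => simpa using const U 0 D B 0
  | insert i s hi ih =>
    have h1 := (h i (Finset.mem_insert_self i s)).add
      (ih fun j hj => h j (Finset.mem_insert_of_mem hj))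
    simp only [Finset.sum_insert hi, Finset.card_insert_of_notMem hi]
    refine h1.mono (by ring_nf; rfl) le_rfl ?_
    push_cast
    linarith

lemma relu (hu : Comp U W D B C u) (hC : C ≤ B) (hW : 0 < W) :
    Comp U W (D + 1) B 1 fun t => max (u t) 0 := by
  obtain ⟨S, h1, h2⟩ := hu
  refine ⟨{fun t => max (u t) 0}, ⟨S, h1, (Finset.card_singleton _).trans_le hW, ?_⟩,
    AffComb.of_mem (Finset.mem_singleton_self _)⟩
  intro h hh
  exact ⟨u, h2.mono hC, Finset.mem_singleton.1 hh⟩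

/-- A signal passes through a further layer as `u = max u 0 - max (-u) 0`. -/
lemma lift (hu : Comp U W D B C u) (hC : C ≤ B) (hW : 0 < W) :
    Comp U (W + W) (D + 1) B 2 u := by
  have h := (hu.relu hC hW).sub (hu.neg.relu hC hW)
  have e : (fun t => max (u t) 0 - max (-u t) 0) = u := by
    funext t
    rcases le_total (u t) 0 with h | h
    · rw [max_eq_right h, max_eq_left (by linarith)]; ring
    · rw [max_eq_left h, max_eq_right (by linarith)]; ring
  rw [e] at h
  exact h.mono le_rfl le_rfl (by norm_num)

/-- `min u v = u - max (u - v) 0`. -/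
lemma min (hu : Comp U W D B C u) (hv : Comp U W D B C v) (hC : 2 * C ≤ B) (hC0 : 0 ≤ C)
    (hW : 0 < W) : Comp U (4 * W) (D + 1) B 3 fun t => Min.min (u t) (v t) := by
  have h := (hu.lift (by linarith) hW).sub ((hu.sub hv).relu (by linarith) (by omega))
  have e : (fun t => u t - max (u t - v t) 0) = fun t => Min.min (u t) (v t) := by
    funext t
    rcases le_total (u t) (v t) with h | h
    · rw [max_eq_right (by linarith), min_eq_left h]; ring
    · rw [max_eq_left (by linarith), min_eq_right h]; ring
  rw [e] at h
  exact h.mono (by omega) le_rfl (by norm_num)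

end Comp

namespace CompAll

variable {U V R : Finset (ℝ → ℝ)} {W W' D D' : ℕ} {B B' C C' : ℝ} {u v : ℝ → ℝ}

lemma mono (h : CompAll U W D B C V) (hW : W ≤ W') (hB : B ≤ B') (hC : C ≤ C') :
    CompAll U W' D B' C' V := by
  obtain ⟨S, h1, h2⟩ := h
  exact ⟨S, h1.mono hW hB, fun v hv => (h2 v hv).mono hC⟩

lemma of_comp (hD : 0 < D) (h : ∀ v ∈ V, Comp U W D B C v) :
    CompAll U (V.card * W) D B C V := by
  classical
  induction V using Finset.induction_on with
  | empty => exact ⟨∅, Layers.empty hD, by simp⟩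
  | insert v V hv ih =>
    obtain ⟨S, h1, h2⟩ := ih fun w hw => h w (Finset.mem_insert_of_mem hw)
    obtain ⟨S', h1', h2'⟩ := h v (Finset.mem_insert_self v V)
    refine ⟨S ∪ S', ?_, fun w hw => ?_⟩
    · rw [Finset.card_insert_of_notMem hv, add_mul, one_mul]
      exact h1.union h1'
    · rcases Finset.mem_insert.1 hw with rfl | hw
      · exact h2'.subset Finset.subset_union_right
      · exact (h2 w hw).subset Finset.subset_union_left

/-- Composition of two blocks of layers. The coefficients of the inner readout enter the weights of
one layer only, and not the readout of the composition, so that bounds do not pile up. -/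
lemma comp (h : CompAll U W D B' C V) (h' : CompAll V W (D' + 1) B C' R) (hC : 0 ≤ C)
    (hB : 0 ≤ B) (hB' : V.card * (B * C) + B ≤ B') : CompAll U W (D + (D' + 1)) B' C' R := by
  obtain ⟨S, h1, h2⟩ := h
  obtain ⟨S', h1', h2'⟩ := h'
  exact ⟨S', h1.append ((h1'.rebase h2 hC hB).mono le_rfl hB'), h2'⟩

lemma pad (h : CompAll U W (D + 1) B C V) (hB : 1 ≤ B) (k : ℕ) :
    CompAll U W (D + k + 1) B C V := by
  obtain ⟨S, h1, h2⟩ := h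
  exact ⟨S, h1.pad hB k, h2⟩

end CompAll

/-! ### From layers to networks -/

/-- A finite set of at most `W` signals is enumerated by `Fin W`, padding with zero signals. -/
lemma Finset.exists_enum {W : ℕ} (S : Finset (ℝ → ℝ)) (hS : S.card ≤ W) :
    ∃ H : Fin W → ℝ → ℝ, (∀ j, H j ∈ S ∨ H j = 0) ∧
      ∀ C u, AffComb C S u → ∃ (a : Fin W → ℝ) (b : ℝ), (∀ j, |a j| ≤ C) ∧ |b| ≤ C ∧
        ∀ t, u t = ∑ j, a j * H j t + b := by
  obtain ⟨r, rfl⟩ := Nat.exists_eq_add_of_le hS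
  refine ⟨Fin.append (fun i => (S.equivFin.symm i : ℝ → ℝ)) (fun _ => 0), fun j => ?_, ?_⟩
  · refine Fin.addCases (fun i => ?_) (fun i => ?_) j
    · left
      simp
    · right
      simp
  · rintro C u ⟨a, b, ha, hb, hu⟩
    refine ⟨Fin.append (fun i => a (S.equivFin.symm i)) (fun _ => 0), b, fun j => ?_, hb,
      fun t => ?_⟩
    · refine Fin.addCases (fun i => ?_) (fun i => ?_) j
      · simpa using ha _
      · simpa using (abs_nonneg b).trans hb
    · rw [hu t, Fin.sum_univ_add]
      simp only [Fin.append_left, Fin.append_right, zero_mul, Finset.sum_const_zero, add_zero]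
      rw [Equiv.sum_comp S.equivFin.symm (fun h : S => a h * (h : ℝ → ℝ) t)]
      rw [Finset.sum_coe_sort S (fun h => a h * h t)]

/-- The neurons of the last layer are enumerated by `Fin W`, and any network that takes them as its
input can be put behind the layers. -/
lemma Layers.exists_net {W N : ℕ} {B : ℝ} (hB : 0 ≤ B) (D : ℕ) (S : Finset (ℝ → ℝ))
    (h : Layers W B (D + 1) {id} S) :
    ∃ H : Fin W → ℝ → ℝ,
      (∀ C u, AffComb C S u → ∃ (a : Fin W → ℝ) (b : ℝ), (∀ j, |a j| ≤ C) ∧ |b| ≤ C ∧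
        ∀ t, u t = ∑ j, a j * H j t + b) ∧
      ∀ (E K : ℕ) (net : ReLUNet W N W E), net.BoundedBy B → K = D + 1 + E →
        ∃ net' : ReLUNet W N 1 K, net'.BoundedBy B ∧
          ∀ t, net'.realize (fun _ => t) = net.realize fun j => H j t := by
  induction D generalizing S with
  | zero =>
    obtain ⟨S', rfl, h2, h3⟩ := h
    obtain ⟨H, hH, hS⟩ := S.exists_enum h2
    refine ⟨H, hS, ?_⟩
    intro E K net hnet hK
    obtain rfl : K = E + 1 := by omega
    have key : ∀ j, ∃ a b : ℝ, |a| ≤ B ∧ |b| ≤ B ∧ ∀ t, H j t = max (a * t + b) 0 := by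
      intro j
      rcases hH j with hj | hj
      · obtain ⟨u, ⟨a, b, ha, hb, hu⟩, e⟩ := h3 _ hj
        exact ⟨a id, b, ha _, hb, fun t => by rw [e]; simp [hu]⟩
      · exact ⟨0, 0, by simpa using hB, by simpa using hB, fun t => by simp [hj]⟩
    choose a b ha hb hab using key
    refine ⟨.hidden (fun j _ => a j) b net, ⟨fun i _ => ha i, hb, hnet⟩, fun t => ?_⟩
    simp only [ReLUNet.realize]
    congr 1
    funext j
    rw [hab]
    simp [Matrix.mulVec, dotProduct]
  | succ D ih =>
    obtain ⟨S', h1, h2, h3⟩ := h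
    obtain ⟨H', hS', hnet'⟩ := ih S' h1
    obtain ⟨H, hH, hS⟩ := S.exists_enum h2
    refine ⟨H, hS, ?_⟩
    intro E K net hnet hK
    have key : ∀ j, ∃ (a : Fin W → ℝ) (b : ℝ), (∀ i, |a i| ≤ B) ∧ |b| ≤ B ∧
        ∀ t, H j t = max (∑ i, a i * H' i t + b) 0 := by
      intro j
      rcases hH j with hj | hj
      · obtain ⟨u, hu, e⟩ := h3 _ hj
        obtain ⟨a, b, ha, hb, hu⟩ := hS' _ _ hu
        exact ⟨a, b, ha, hb, fun t => by rw [e]; simp [hu]⟩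
      · exact ⟨0, 0, fun _ => by simpa using hB, by simpa using hB, fun t => by simp [hj]⟩
    choose a b ha hb hab using key
    obtain ⟨net', hb', hr⟩ := hnet' (E + 1) K (.hidden (fun j => a j) b net)
      ⟨fun i j => ha i j, hb, hnet⟩ (by omega)
    refine ⟨net', hb', fun t => ?_⟩
    rw [hr]
    simp only [ReLUNet.realize]
    congr 1
    funext j
    rw [hab]
    simp [Matrix.mulVec, dotProduct]

/-- Signals computed from the input `t` by layers are the outputs of a network. -/
lemma exists_net_of_comp {W N D : ℕ} {B : ℝ} {f : Fin N → ℝ → ℝ} {V : Finset (ℝ → ℝ)}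
    (hD : 0 < D) (h : CompAll {id} W D B B V) (hf : ∀ i, f i ∈ V) (hB : 0 ≤ B) :
    ∃ net : ReLUNet W N 1 D, net.BoundedBy B ∧
      ∀ t, net.realize (fun _ => t) = fun i => f i t := by
  obtain ⟨D, rfl⟩ := Nat.exists_eq_succ_of_ne_zero hD.ne'
  obtain ⟨S, h1, h2⟩ := h
  obtain ⟨H, hS, hnet⟩ := Layers.exists_net (N := N) hB D S h1
  choose a b ha hb hab using fun i => hS _ _ (h2 (f i) (hf i))
  obtain ⟨net, h3, h4⟩ := hnet 0 (D + 1) (.output (fun i => a i) b) ⟨fun i j => ha i j, hb⟩ rfl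
  refine ⟨net, h3, fun t => ?_⟩
  rw [h4]
  funext i
  simp [ReLUNet.realize, Matrix.mulVec, dotProduct, hab]

/-! ### Gates, tents and hats -/

/-- `gate B c y` is `y` if `1 ≤ c` and `0` if `c ≤ -1`, as long as `|y| ≤ B`. -/
noncomputable def gate (B c y : ℝ) : ℝ := max (y + B * c) 0 - max (B * c) 0

lemma gate_of_one_le {B c y : ℝ} (hy : |y| ≤ B) (hc : 1 ≤ c) : gate B c y = y := by
  have hB : 0 ≤ B := (abs_nonneg y).trans hy
  have h1 : B ≤ B * c := le_mul_of_one_le_right hB hc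
  have h2 := neg_le_of_abs_le hy
  rw [gate, max_eq_left (by linarith), max_eq_left (by linarith)]
  ring

lemma gate_of_le_neg_one {B c y : ℝ} (hy : |y| ≤ B) (hc : c ≤ -1) : gate B c y = 0 := by
  have hB : 0 ≤ B := (abs_nonneg y).trans hy
  have h1 : B * c ≤ B * (-1) := mul_le_mul_of_nonneg_left hc hB
  have h2 := le_of_abs_le hy
  rw [gate, max_eq_right (by linarith), max_eq_right (by linarith)]
  ring

lemma abs_gate_le (B c y : ℝ) : |gate B c y| ≤ |y| := by
  have := abs_max_sub_max_le_abs (y + B * c) (B * c) 0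
  simpa [gate] using this

lemma gate_nonneg {B c y : ℝ} (hy : 0 ≤ y) : 0 ≤ gate B c y :=
  sub_nonneg.2 (max_le_max (by linarith) le_rfl)

/-- The tent over the interval `[d / M, (d + 1) / M]`, positive exactly in its interior. -/
noncomputable def tent (M d : ℕ) (x : ℝ) : ℝ := x - d / M - max (2 * x - (2 * d + 1) / M) 0

lemma tent_eq_min (M d : ℕ) (x : ℝ) :
    tent M d x = min (x - d / M) ((d + 1) / M - x) := by
  have e : x - d / M - ((d + 1) / M - x) = 2 * x - (2 * d + 1) / M := by ring
  rcases le_total (x - d / M) ((d + 1) / M - x) with h | h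
  · rw [tent, min_eq_left h, max_eq_right (by linarith)]; ring
  · rw [tent, min_eq_right h, max_eq_left (by linarith)]; linarith

/-- The hat function with nodes `a < b < c` and height `1`. -/
noncomputable def hat (a b c x : ℝ) : ℝ := max (min ((x - a) / (b - a)) ((c - x) / (c - b))) 0

lemma hat_eq_zero_of_le {a b c x : ℝ} (hab : a < b) (hx : x ≤ a) : hat a b c x = 0 :=
  max_eq_right ((min_le_left _ _).trans
    (div_nonpos_of_nonpos_of_nonneg (by linarith) (by linarith)))

lemma hat_eq_zero_of_ge {a b c x : ℝ} (hbc : b < c) (hx : c ≤ x) : hat a b c x = 0 :=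
  max_eq_right ((min_le_right _ _).trans
    (div_nonpos_of_nonpos_of_nonneg (by linarith) (by linarith)))

lemma hat_mul_eq_zero {ι : Type*} {a b c x : ℝ} (v : ι → ℝ) (hab : a < b) (hbc : b < c)
    (hx : x ≤ a ∨ c ≤ x) : (fun i => hat a b c x * v i) = 0 := by
  funext i
  rcases hx with h | h
  · simp [hat_eq_zero_of_le hab h]
  · simp [hat_eq_zero_of_ge hbc h]

/-- The piecewise linear function of `(σ, q, x)` that is `σ * hat a b c x` if `q = σ * x`, although
it contains no product of variables, and that vanishes for `x` within `ε` of `0` or `1`, whatever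
`σ` and `q` are. -/
noncomputable def hatReadout (B ε a b c σ q x : ℝ) : ℝ :=
  max (min (min ((q - a * σ) / (b - a)) ((c * σ - q) / (c - b)))
      (min (B / ε * (x - ε)) (B / ε * (1 - ε - x)))) 0 -
    max (min (min (-((q - a * σ) / (b - a))) (-((c * σ - q) / (c - b))))
      (min (B / ε * (x - ε)) (B / ε * (1 - ε - x)))) 0

lemma hatReadout_eq_zero {B ε a b c σ q x : ℝ} (hB : 0 ≤ B) (hε : 0 < ε)
    (hx : x ≤ ε ∨ 1 - ε ≤ x) : hatReadout B ε a b c σ q x = 0 := by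
  have hBε : 0 ≤ B / ε := by positivity
  have h : min (B / ε * (x - ε)) (B / ε * (1 - ε - x)) ≤ 0 := by
    rcases hx with hx | hx
    · exact (min_le_left _ _).trans (mul_nonpos_of_nonneg_of_nonpos hBε (by linarith))
    · exact (min_le_right _ _).trans (mul_nonpos_of_nonneg_of_nonpos hBε (by linarith))
  rw [hatReadout, max_eq_right ((min_le_right _ _).trans h),
    max_eq_right ((min_le_right _ _).trans h), sub_zero]

lemma hatReadout_zero (B ε a b c x : ℝ) : hatReadout B ε a b c 0 0 x = 0 := by
  simp [hatReadout]

lemma hatReadout_of_nonneg {B ε a b c σ x : ℝ} (hσ : 0 ≤ σ) (hσB : σ ≤ B) (hε : 0 < ε)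
    (ha : 2 * ε ≤ a) (hab : a < b) (hbc : b < c) (hc : c ≤ 1 - 2 * ε) :
    max (min (min (σ * ((x - a) / (b - a))) (σ * ((c - x) / (c - b))))
      (min (B / ε * (x - ε)) (B / ε * (1 - ε - x)))) 0 -
    max (min (min (-(σ * ((x - a) / (b - a)))) (-(σ * ((c - x) / (c - b)))))
      (min (B / ε * (x - ε)) (B / ε * (1 - ε - x)))) 0 = σ * hat a b c x := by
  have hB : 0 ≤ B := hσ.trans hσB
  have hBε : 0 ≤ B / ε := by positivity
  have e : B / ε * ε = B := by field_simp
  have h1 : 0 ≤ b - a := by linarith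
  have h2 : 0 ≤ c - b := by linarith
  have hneg : min (-(σ * ((x - a) / (b - a)))) (-(σ * ((c - x) / (c - b)))) ≤ 0 := by
    rcases le_total a x with h | h
    · refine (min_le_left _ _).trans ?_
      have : 0 ≤ σ * ((x - a) / (b - a)) := mul_nonneg hσ (div_nonneg (by linarith) h1)
      linarith
    · refine (min_le_right _ _).trans ?_
      have : 0 ≤ σ * ((c - x) / (c - b)) := mul_nonneg hσ (div_nonneg (by linarith) h2)
      linarith
  rw [max_eq_right ((min_le_left _ _).trans hneg), sub_zero, ← mul_min_of_nonneg _ _ hσ]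
  by_cases hx : a ≤ x ∧ x ≤ c
  · -- on the support of the hat, the cut-off is at least `B`
    have hw : B ≤ min (B / ε * (x - ε)) (B / ε * (1 - ε - x)) := by
      refine le_min ?_ ?_
      · calc B = B / ε * ε := e.symm
          _ ≤ _ := mul_le_mul_of_nonneg_left (by linarith) hBε
      · calc B = B / ε * ε := e.symm
          _ ≤ _ := mul_le_mul_of_nonneg_left (by linarith) hBε
    have hm0 : 0 ≤ min ((x - a) / (b - a)) ((c - x) / (c - b)) :=
      le_min (div_nonneg (by linarith) h1) (div_nonneg (by linarith) h2)
    have hm1 : min ((x - a) / (b - a)) ((c - x) / (c - b)) ≤ 1 := by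
      rcases le_total x b with h | h
      · exact (min_le_left _ _).trans ((div_le_one (by linarith)).2 (by linarith))
      · exact (min_le_right _ _).trans ((div_le_one (by linarith)).2 (by linarith))
    rw [min_eq_left, hat, max_eq_left hm0, max_eq_left (mul_nonneg hσ hm0)]
    exact (mul_le_of_le_one_right hσ hm1).trans (hσB.trans hw)
  · have hm : min ((x - a) / (b - a)) ((c - x) / (c - b)) ≤ 0 := by
      by_contra! hcon
      obtain ⟨h3, h4⟩ := lt_min_iff.1 hcon
      refine hx ⟨?_, ?_⟩
      · by_contra! h
        exact absurd (div_nonpos_of_nonpos_of_nonneg (by linarith : x - a ≤ 0) h1) (not_le.2 h3)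
      · by_contra! h
        exact absurd (div_nonpos_of_nonpos_of_nonneg (by linarith : c - x ≤ 0) h2) (not_le.2 h4)
    rw [hat, max_eq_right hm, mul_zero, max_eq_right]
    exact (min_le_left _ _).trans (mul_nonpos_of_nonneg_of_nonpos hσ hm)

lemma hatReadout_eq {B ε a b c σ x : ℝ} (hσB : |σ| ≤ B) (hε : 0 < ε)
    (ha : 2 * ε ≤ a) (hab : a < b) (hbc : b < c) (hc : c ≤ 1 - 2 * ε) :
    hatReadout B ε a b c σ (σ * x) x = σ * hat a b c x := by
  have e1 : (σ * x - a * σ) / (b - a) = σ * ((x - a) / (b - a)) := by ring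
  have e2 : (c * σ - σ * x) / (c - b) = σ * ((c - x) / (c - b)) := by ring
  rw [hatReadout, e1, e2]
  rcases le_total 0 σ with hσ | hσ
  · exact hatReadout_of_nonneg hσ (le_of_abs_le hσB) hε ha hab hbc hc
  · have h := hatReadout_of_nonneg (x := x) (neg_nonneg.2 hσ)
      (neg_le_of_neg_le (neg_le_of_abs_le hσB)) hε ha hab hbc hc
    simp only [neg_mul, neg_neg] at h
    rw [← neg_sub, h, neg_neg]

/-! ### Refinement on the unit interval -/

section Cell

variable {M : ℕ} {ι : Type*} [Fintype ι]

/-- The iterates of the refinement operator in vectorized form: if `F₀` is supported in `[0, 1]`,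
then on the `d`-th of the `M` equal parts of `[0, 1]` the refinement of `F` is
`x ↦ T d * F (M x - d)`. -/
noncomputable def cell (T : Fin M → Matrix ι ι ℝ) (F₀ : ℝ → ι → ℝ) : ℕ → ℝ → ι → ℝ
  | 0, x => F₀ x
  | n + 1, x => ∑ d : Fin M, (T d).mulVec (cell T F₀ n (M * x - d))

variable {T : Fin M → Matrix ι ι ℝ} {F₀ : ℝ → ι → ℝ}

lemma cell_eq_zero_of_near {ε : ℝ} (h0 : ∀ (x : ℝ) (j : ℤ), |x - j| ≤ ε → F₀ x = 0) (n : ℕ) (x : ℝ)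
    (j : ℤ) (hx : |(M : ℝ) ^ n * x - j| ≤ ε) : cell T F₀ n x = 0 := by
  induction n generalizing x j with
  | zero => exact h0 x j (by simpa using hx)
  | succ n ih =>
    refine Finset.sum_eq_zero fun d _ => ?_
    rw [ih (M * x - d) (j - M ^ n * d), Matrix.mulVec_zero]
    convert hx using 2
    push_cast
    ring

lemma cell_eq_zero_of_notMem (h0 : ∀ x : ℝ, x ≤ 0 ∨ 1 ≤ x → F₀ x = 0) (n : ℕ) (x : ℝ)
    (hx : x ≤ 0 ∨ 1 ≤ x) : cell T F₀ n x = 0 := by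
  induction n generalizing x with
  | zero => exact h0 x hx
  | succ n ih =>
    refine Finset.sum_eq_zero fun d _ => ?_
    have hd : (d : ℝ) + 1 ≤ M := by exact_mod_cast d.2
    have hd0 : (0 : ℝ) ≤ (d : ℕ) := Nat.cast_nonneg _
    rw [ih, Matrix.mulVec_zero]
    rcases hx with hx | hx
    · left
      nlinarith
    · right
      nlinarith

lemma cell_succ_eq (h0 : ∀ x : ℝ, x ≤ 0 ∨ 1 ≤ x → F₀ x = 0) (n : ℕ) (x : ℝ) (d : Fin M)
    (h1 : (d : ℝ) ≤ M * x) (h2 : M * x ≤ d + 1) :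
    cell T F₀ (n + 1) x = (T d).mulVec (cell T F₀ n (M * x - d)) := by
  refine Finset.sum_eq_single d (fun e _ he => ?_) (by simp)
  rw [cell_eq_zero_of_notMem h0, Matrix.mulVec_zero]
  rcases lt_or_gt_of_ne (Fin.val_ne_of_ne he) with h | h
  · right
    have : (e : ℝ) + 1 ≤ d := by exact_mod_cast h
    linarith
  · left
    have : (d : ℝ) + 1 ≤ e := by exact_mod_cast h
    linarith

/-- A state of the evaluation of `∑ i, w i * cell T F₀ n x i`: the current weights `w`, the products
`w i * x`, which a network cannot form later, and the position `x` in the unit interval. -/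
structure State (ι : Type*) where
  weight : ι → ℝ
  moment : ι → ℝ
  pos : ℝ

/-- One step of the evaluation. The digit `d` with `d ≤ M x ≤ d + 1` is selected by gates. The
gates for the weights and moments are closed near the multiples of `1 / M`, and they open in a
region where the gates for the position are fully open already. -/
noncomputable def State.step (T : Fin M → Matrix ι ι ℝ) (B κ : ℝ) (s : State ι) : State ι where
  weight j := ∑ d : Fin M, gate B (κ * tent M d s.pos - 3) (∑ i, T d i j * s.weight i)
  moment j := ∑ d : Fin M, gate B (κ * tent M d s.pos - 3)
    (∑ i, T d i j * (M * s.moment i - d * s.weight i))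
  pos := ∑ d : Fin M, gate B (κ * tent M d s.pos - 1) (M * s.pos - d)

/-- The value read off from the final state, for `F₀ x = hat a b c x • v`. -/
noncomputable def State.out (B ε a b c : ℝ) (v : ι → ℝ) (s : State ι) : ℝ :=
  ∑ i, v i * hatReadout B ε a b c (s.weight i) (s.moment i) s.pos

/-- The digit of `x` in `[0, 1]`, with `M - 1` for `x = 1`. -/
lemma exists_digit (hM : 0 < M) {x : ℝ} (h0 : 0 ≤ x) (h1 : x ≤ 1) :
    ∃ d : Fin M, (d : ℝ) ≤ M * x ∧ M * x ≤ d + 1 := by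
  have hM' : (0 : ℝ) < M := by exact_mod_cast hM
  rcases h1.lt_or_eq with h | rfl
  · have hx : 0 ≤ M * x := by positivity
    refine ⟨⟨⌊M * x⌋₊, (Nat.floor_lt hx).2 (by nlinarith)⟩, Nat.floor_le hx,
      (Nat.lt_floor_add_one _).le⟩
  · refine ⟨⟨M - 1, by omega⟩, ?_, ?_⟩
    · simp
    · simp [Nat.cast_sub hM]

variable {R B κ ε β : ℝ}

lemma abs_transpose_sum_le (hR : ∀ d j, 2 * M * ∑ i, |T d i j| ≤ R) (d : Fin M) (j : ι)
    (w : ι → ℝ) (hw : ∀ i, |w i| ≤ 2 * M * β) : |∑ i, T d i j * w i| ≤ R * β := by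
  have hM : (0 : ℝ) < M := by exact_mod_cast d.pos
  have hβ : 0 ≤ β := by
    have := (abs_nonneg _).trans (hw j)
    by_contra! h
    nlinarith
  calc |∑ i, T d i j * w i| ≤ ∑ i, |T d i j| * (2 * M * β) := by
        refine (Finset.abs_sum_le_sum_abs _ _).trans (Finset.sum_le_sum fun i _ => ?_)
        rw [abs_mul]
        exact mul_le_mul_of_nonneg_left (hw i) (abs_nonneg _)
    _ = (2 * M * ∑ i, |T d i j|) * β := by rw [← Finset.sum_mul]; ring
    _ ≤ R * β := mul_le_mul_of_nonneg_right (hR d j) hβ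

/-- Off the selected digit all gates are closed. -/
lemma sum_gate_eq {x e : ℝ} (he : 1 ≤ e) (hκ : 0 ≤ κ) (d : Fin M) (h1 : (d : ℝ) ≤ M * x)
    (h2 : M * x ≤ d + 1) (y : Fin M → ℝ) (hy : ∀ d, |y d| ≤ B) :
    ∑ d : Fin M, gate B (κ * tent M d x - e) (y d) = gate B (κ * tent M d x - e) (y d) := by
  have hM : (0 : ℝ) < M := by exact_mod_cast d.pos
  refine Finset.sum_eq_single d (fun f _ hf => gate_of_le_neg_one (hy f) ?_) (by simp)
  have ht : tent M f x ≤ 0 := by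
    rw [tent_eq_min]
    rcases lt_or_gt_of_ne (Fin.val_ne_of_ne hf) with h | h
    · have : (f : ℝ) + 1 ≤ d := by exact_mod_cast h
      refine (min_le_right _ _).trans (sub_nonpos.2 ((div_le_iff₀ hM).2 ?_))
      linarith
    · have : (d : ℝ) + 1 ≤ f := by exact_mod_cast h
      refine (min_le_left _ _).trans (sub_nonpos.2 ((le_div_iff₀ hM).2 ?_))
      linarith
  nlinarith

/-- The invariant of the evaluation with `k` steps to go: the moments are exact, or `x` is so close
to the grid `M⁻ᵏ ℤ` that the value is `0` whatever the weights are, or the weights are `0`. -/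
def State.Valid (M : ℕ) (ε : ℝ) (k : ℕ) (s : State ι) : Prop :=
  (∀ i, s.moment i = s.weight i * s.pos) ∨ (∃ j : ℤ, |(M : ℝ) ^ k * s.pos - j| ≤ ε) ∨
    ∀ i, s.weight i = 0 ∧ s.moment i = 0

lemma State.out_iterate {a b c : ℝ} (v : ι → ℝ) (hM : 0 < M)
    (hR1 : 1 ≤ R) (hR : ∀ d j, 2 * M * ∑ i, |T d i j| ≤ R) (hε : 0 < ε)
    (ha : 2 * ε ≤ a) (hab : a < b) (hbc : b < c) (hc : c ≤ 1 - 2 * ε) (hMB : M ≤ B)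
    (k : ℕ) (hκ : 4 * (M : ℝ) ^ k ≤ ε * κ) (s : State ι) (h0 : 0 ≤ s.pos) (h1 : s.pos ≤ 1)
    (hw : ∀ i, |s.weight i| ≤ β) (hm : ∀ i, |s.moment i| ≤ β) (hβ : 0 ≤ β) (hβB : R ^ k * β ≤ B)
    (hs : s.Valid M ε k) :
    ((State.step T B κ)^[k] s).out B ε a b c v =
      ∑ i, s.weight i * cell T (fun x i => hat a b c x * v i) k s.pos i := by
  have hM0 : (0 : ℝ) < M := by exact_mod_cast hM
  have hM1 : (1 : ℝ) ≤ M := by exact_mod_cast hM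
  have hnear : ∀ (x : ℝ) (j : ℤ), |x - j| ≤ ε → (x ≤ ε ∨ 1 - ε ≤ x) := by
    intro x j hx
    obtain ⟨h3, h4⟩ := abs_le.1 hx
    rcases le_or_gt j 0 with hj | hj
    · have : (j : ℝ) ≤ 0 := by exact_mod_cast hj
      left; linarith
    · have : (1 : ℝ) ≤ j := by exact_mod_cast hj
      right; linarith
  have hF : ∀ (x : ℝ) (j : ℤ), |x - j| ≤ ε → (fun i => hat a b c x * v i) = 0 := by
    intro x j hx
    exact hat_mul_eq_zero v hab hbc
      ((hnear x j hx).imp (fun h => by linarith) fun h => by linarith)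
  have hF' : ∀ x : ℝ, x ≤ 0 ∨ 1 ≤ x → (fun i => hat a b c x * v i) = 0 := by
    intro x hx
    exact hat_mul_eq_zero v hab hbc (hx.imp (fun h => by linarith) fun h => by linarith)
  induction k generalizing s β with
  | zero =>
    simp only [Function.iterate_zero, id, State.out, cell]
    refine Finset.sum_congr rfl fun i _ => ?_
    rcases hs with hs | ⟨j, hj⟩ | hs
    · rw [hs i, hatReadout_eq ((hw i).trans (by simpa using hβB)) hε ha hab hbc hc]
      ring
    · have hj' : |s.pos - j| ≤ ε := by simpa using hj
      rw [hatReadout_eq_zero (by linarith) hε (hnear _ j hj'), show hat a b c s.pos * v i = 0 from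
        congrFun (hF _ j hj') i]
      ring
    · rw [(hs i).1, (hs i).2, hatReadout_zero]
      ring
  | succ k ih =>
    rw [Function.iterate_succ_apply]
    have hκ0 : 0 < κ := by
      have : (0 : ℝ) < M ^ (k + 1) := by positivity
      by_contra! h
      nlinarith
    have hRβ : R * β ≤ B := by
      refine le_trans ?_ hβB
      exact mul_le_mul_of_nonneg_right (le_self_pow₀ hR1 (by omega)) hβ
    obtain ⟨d, hd1, hd2⟩ := exists_digit hM h0 h1
    set x := s.pos with hx
    have hwd : ∀ e j, |∑ i, T e i j * s.weight i| ≤ R * β := fun e j =>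
      abs_transpose_sum_le hR e j _ fun i => (hw i).trans (by nlinarith)
    have hmd : ∀ e j, |∑ i, T e i j * (M * s.moment i - e * s.weight i)| ≤ R * β := by
      refine fun e j => abs_transpose_sum_le hR e j _ fun i => ?_
      have he : (e : ℝ) ≤ M := by exact_mod_cast e.2.le
      refine (abs_sub _ _).trans ?_
      rw [abs_mul, abs_mul, Nat.abs_cast, Nat.abs_cast]
      have h3 : M * |s.moment i| ≤ M * β := mul_le_mul_of_nonneg_left (hm i) hM0.le
      have h4 : e * |s.weight i| ≤ M * β := mul_le_mul he (hw i) (abs_nonneg _) hM0.le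
      linarith
    have hpd : ∀ e : Fin M, |M * x - e| ≤ B := by
      intro e
      have he : (e : ℝ) ≤ M := by exact_mod_cast e.2.le
      have he0 : (0 : ℝ) ≤ (e : ℕ) := Nat.cast_nonneg _
      rw [abs_le]
      constructor <;> nlinarith
    have eW : ∀ j, (s.step T B κ).weight j =
        gate B (κ * tent M d x - 3) (∑ i, T d i j * s.weight i) := fun j =>
      sum_gate_eq (by norm_num) hκ0.le d hd1 hd2 (fun e => ∑ i, T e i j * s.weight i)
        fun e => (hwd e j).trans hRβ
    have eM : ∀ j, (s.step T B κ).moment j =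
        gate B (κ * tent M d x - 3) (∑ i, T d i j * (M * s.moment i - d * s.weight i)) := fun j =>
      sum_gate_eq (by norm_num) hκ0.le d hd1 hd2
        (fun e => ∑ i, T e i j * (M * s.moment i - e * s.weight i))
        fun e => (hmd e j).trans hRβ
    have eP : (s.step T B κ).pos = gate B (κ * tent M d x - 1) (M * x - d) :=
      sum_gate_eq (by norm_num) hκ0.le d hd1 hd2 (fun e => M * x - e) hpd
    have hp0 : 0 ≤ (s.step T B κ).pos := eP ▸ gate_nonneg (by linarith)
    have hp1 : (s.step T B κ).pos ≤ 1 := by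
      rw [eP]
      refine (le_abs_self _).trans ((abs_gate_le _ _ _).trans ?_)
      rw [abs_of_nonneg] <;> linarith
    have key := fun h => ih (by
        refine le_trans ?_ hκ
        rw [pow_succ]
        have : (0 : ℝ) < M ^ k := by positivity
        nlinarith) (s.step T B κ) hp0 hp1
      (fun j => by rw [eW]; exact (abs_gate_le _ _ _).trans (hwd d j))
      (fun j => by rw [eM]; exact (abs_gate_le _ _ _).trans (hmd d j))
      (mul_nonneg (by linarith) hβ) (by rw [← mul_assoc, ← pow_succ]; exact hβB) h
    -- points at distance at most `4 / κ` from the multiples of `1 / M` are close to the grid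
    have hgrid : κ * tent M d x ≤ 4 → ∃ j : ℤ, |(M : ℝ) ^ (k + 1) * x - j| ≤ ε := by
      intro h
      have hMk : (0 : ℝ) < M ^ k := by positivity
      have ht : tent M d x ≤ ε / (M : ℝ) ^ (k + 1) := by
        rw [le_div_iff₀ (by positivity)]
        by_contra! hcon
        have := mul_lt_mul_of_pos_left hcon hκ0
        have h4 : κ * (tent M d x * (M : ℝ) ^ (k + 1)) ≤ 4 * (M : ℝ) ^ (k + 1) := by
          rw [← mul_assoc]
          exact mul_le_mul_of_nonneg_right h (by positivity)
        linarith
      rw [tent_eq_min, min_le_iff] at ht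
      rcases ht with ht | ht
      · refine ⟨M ^ k * d, ?_⟩
        have e : (M : ℝ) ^ (k + 1) * x - ((M ^ k * d : ℤ) : ℝ) = M ^ k * (M * x - d) := by
          push_cast; ring
        rw [e, abs_of_nonneg (mul_nonneg hMk.le (by linarith))]
        rw [le_div_iff₀ (by positivity)] at ht
        refine le_of_eq_of_le ?_ ht
        field_simp
        ring
      · refine ⟨M ^ k * (d + 1), ?_⟩
        have e : (M : ℝ) ^ (k + 1) * x - ((M ^ k * (d + 1) : ℤ) : ℝ) =
            -(M ^ k * (d + 1 - M * x)) := by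
          push_cast; ring
        rw [e, abs_neg, abs_of_nonneg (mul_nonneg hMk.le (by linarith))]
        rw [le_div_iff₀ (by positivity)] at ht
        refine le_of_eq_of_le ?_ ht
        field_simp
        ring
    have hshift : (∃ j : ℤ, |(M : ℝ) ^ (k + 1) * x - j| ≤ ε) →
        ∃ j : ℤ, |(M : ℝ) ^ k * (M * x - d) - j| ≤ ε := by
      rintro ⟨j, hj⟩
      refine ⟨j - M ^ k * d, le_of_eq_of_le ?_ hj⟩
      push_cast
      ring_nf
    have hvanish : (∃ j : ℤ, |(M : ℝ) ^ (k + 1) * x - j| ≤ ε) →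
        ∑ i, s.weight i * cell T (fun x i => hat a b c x * v i) (k + 1) x i = 0 := by
      rintro ⟨j, hj⟩
      rw [cell_eq_zero_of_near hF (k + 1) x j hj]
      simp
    rcases le_or_gt (κ * tent M d x) 2 with hc1 | hc1
    · -- all gates for the weights are closed
      have hW : ∀ j, (s.step T B κ).weight j = 0 := fun j => by
        rw [eW, gate_of_le_neg_one ((hwd d j).trans hRβ) (by linarith)]
      have hMo : ∀ j, (s.step T B κ).moment j = 0 := fun j => by
        rw [eM, gate_of_le_neg_one ((hmd d j).trans hRβ) (by linarith)]
      rw [key (Or.inr (Or.inr fun i => ⟨hW i, hMo i⟩)), hvanish (hgrid (by linarith))]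
      simp [hW]
    · have hP : (s.step T B κ).pos = M * x - d := by
        rw [eP, gate_of_one_le (hpd d) (by linarith)]
      rcases lt_or_ge (κ * tent M d x) 4 with hc2 | hc2
      · -- the gates for the weights are half open
        have hg := hgrid hc2.le
        obtain ⟨j, hj⟩ := hshift hg
        rw [key (Or.inr (Or.inl ⟨j, by rwa [hP]⟩)), hvanish hg, hP,
          cell_eq_zero_of_near hF k _ j hj]
        simp
      · -- the gates of the digit `d` are open
        have hW : ∀ j, (s.step T B κ).weight j = ∑ i, T d i j * s.weight i := fun j => by
          rw [eW, gate_of_one_le ((hwd d j).trans hRβ) (by linarith)]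
        have hMo : ∀ j, (s.step T B κ).moment j =
            ∑ i, T d i j * (M * s.moment i - d * s.weight i) := fun j => by
          rw [eM, gate_of_one_le ((hmd d j).trans hRβ) (by linarith)]
        rw [key, hP, cell_succ_eq hF' k x d hd1 hd2]
        · simp only [hW, Matrix.mulVec, dotProduct, Finset.sum_mul, Finset.mul_sum]
          rw [Finset.sum_comm]
          refine Finset.sum_congr rfl fun i _ => Finset.sum_congr rfl fun j _ => ?_
          ring
        · rcases hs with hs | hs | hs
          · left
            intro j
            rw [hMo, hW, hP, Finset.sum_mul]
            refine Finset.sum_congr rfl fun i _ => ?_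
            rw [hs i]
            ring
          · right; left
            rw [hP]
            exact hshift hs
          · right; right
            intro j
            rw [hW, hMo]
            simp [hs]

end Cell

/-! ### The evaluation as a network -/

section Network

variable {M : ℕ} {ι : Type*} [Fintype ι] {T : Fin M → Matrix ι ι ℝ}
variable {U : Finset (ℝ → ℝ)} {R B κ ε β C Λ : ℝ}

/-- A gate whose opening is controlled by a tent costs two hidden layers. -/
lemma Comp.gate_tent {x y : ℝ → ℝ} {Y e : ℝ} (d : Fin M) (hx : x ∈ U) (hy : Comp U 1 0 β Y y)
    (hB : 0 ≤ B) (hκ : 0 ≤ κ) (he : |e| ≤ 3) (hβ : Y + 2 * (B * κ) + 3 * B + 4 ≤ β) :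
    Comp U 6 2 β 2 fun t => gate B (κ * tent M d (x t) - e) (y t) := by
  have hM : (0 : ℝ) < M := by exact_mod_cast d.pos
  have hd : (d : ℝ) + 1 ≤ M := by exact_mod_cast d.2
  have hd0 : (0 : ℝ) ≤ (d : ℕ) := Nat.cast_nonneg _
  have hBκ : 0 ≤ B * κ := mul_nonneg hB hκ
  have hX : Comp U 0 0 β 1 x := Comp.affine (AffComb.of_mem hx)
  have hr : Comp U 1 1 β 1 fun t => max (2 * x t + -((2 * d + 1) / M)) 0 := by
    have hc : |(-((2 * d + 1) / M) : ℝ)| ≤ 2 := by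
      rw [abs_neg, abs_of_nonneg (by positivity), div_le_iff₀ hM]
      linarith
    have hY : 0 ≤ Y := by
      obtain ⟨S, _, h⟩ := hy
      exact h.nonneg
    refine Comp.relu (C := 4) ?_ (by linarith) one_pos
    refine ((hX.smul 2).add (Comp.const U 1 0 β (-((2 * d + 1) / M)))).mono (by norm_num) le_rfl ?_
    rw [abs_two]
    linarith
  have hpre : ∀ {z : ℝ → ℝ} {Z : ℝ}, Comp U 1 0 β Z z → Z ≤ Y →
      Comp U 3 2 β 1 fun t => max (z t + B * (κ * tent M d (x t) - e)) 0 := by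
    intro z Z hz hZ
    have hdM : (d : ℝ) / M ≤ 1 := (div_le_one hM).2 (by linarith)
    have hc : |(-(B * κ * (d / M)) - B * e : ℝ)| ≤ B * κ + 3 * B := by
      refine (abs_sub _ _).trans (add_le_add ?_ ?_)
      · rw [abs_neg, abs_of_nonneg (by positivity)]
        exact mul_le_of_le_one_right hBκ hdM
      · rw [abs_mul, abs_of_nonneg hB]
        nlinarith
    have h1 := (hz.add (hX.smul (B * κ))).add (Comp.const U 0 0 β (-(B * κ * (d / M)) - B * e))
    have h2 := (h1.mono le_rfl le_rfl
      (show _ ≤ Y + 2 * (B * κ) + 3 * B by rw [abs_of_nonneg hBκ]; linarith)).lift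
      (by linarith) one_pos
    have h3 := (h2.add (hr.smul (-(B * κ)))).relu (W := 3) (by
      rw [abs_neg, abs_of_nonneg hBκ]
      obtain ⟨S, _, h⟩ := hz
      linarith [h.nonneg]) (by norm_num)
    refine Eq.subst (motive := Comp U 3 2 β 1) (funext fun t => ?_) h3
    congr 1
    rw [tent]
    ring_nf
  have hY : 0 ≤ Y := by
    obtain ⟨S, _, h⟩ := hy
    exact h.nonneg
  have h := (hpre hy le_rfl).sub (hpre (Comp.const U 1 0 β 0) (by simpa using hY))
  simp only [zero_add] at h
  exact h.mono le_rfl le_rfl (by norm_num)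

lemma Comp.readout {B ε a b c K : ℝ} {σ q x : ℝ → ℝ} (hσ : σ ∈ U) (hq : q ∈ U) (hx : x ∈ U)
    (hB : 0 ≤ B) (hε : 0 < ε) (hε1 : ε ≤ 1) (ha : |a| ≤ 1) (hc : |c| ≤ 1) (hab : a < b)
    (hbc : b < c) (hK1 : 2 / (b - a) ≤ K) (hK2 : 2 / (c - b) ≤ K)
    (hβ : 4 * (B / ε) + 2 * K + 6 ≤ β) :
    Comp U 32 3 β 2 fun t => hatReadout B ε a b c (σ t) (q t) (x t) := by
  have hBε : 0 ≤ B / ε := by positivity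
  have h1 : 0 < b - a := by linarith
  have h2 : 0 < c - b := by linarith
  have hK : 0 ≤ K := le_trans (by positivity) hK1
  set Y := 2 * (B / ε) + K with hY
  have hS : Comp U 0 0 β 1 σ := Comp.affine (AffComb.of_mem hσ)
  have hQ : Comp U 0 0 β 1 q := Comp.affine (AffComb.of_mem hq)
  have hX : Comp U 0 0 β 1 x := Comp.affine (AffComb.of_mem hx)
  have y1 : Comp U 1 0 β Y fun t => (q t - a * σ t) / (b - a) := by
    have h := (hQ.sub (hS.smul a)).smul (1 / (b - a))
    refine Eq.subst (motive := Comp U 1 0 β Y) (funext fun t => ?_) (h.mono (by norm_num) le_rfl ?_)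
    · ring
    · rw [abs_of_nonneg (by positivity)]
      have : 1 / (b - a) * (1 + |a| * 1) ≤ 1 / (b - a) * 2 :=
        mul_le_mul_of_nonneg_left (by linarith) (by positivity)
      have e : 1 / (b - a) * 2 = 2 / (b - a) := by ring
      linarith
  have y2 : Comp U 1 0 β Y fun t => (c * σ t - q t) / (c - b) := by
    have h := ((hS.smul c).sub hQ).smul (1 / (c - b))
    refine Eq.subst (motive := Comp U 1 0 β Y) (funext fun t => ?_) (h.mono (by norm_num) le_rfl ?_)
    · ring
    · rw [abs_of_nonneg (by positivity)]
      have : 1 / (c - b) * (|c| * 1 + 1) ≤ 1 / (c - b) * 2 :=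
        mul_le_mul_of_nonneg_left (by linarith) (by positivity)
      have e : 1 / (c - b) * 2 = 2 / (c - b) := by ring
      linarith
  have w1 : Comp U 1 0 β Y fun t => B / ε * (x t - ε) := by
    have h := (hX.sub (Comp.const U 1 0 β ε)).smul (B / ε)
    refine h.mono (by norm_num) le_rfl ?_
    rw [abs_of_nonneg hBε, abs_of_nonneg hε.le]
    nlinarith
  have w2 : Comp U 1 0 β Y fun t => B / ε * (1 - ε - x t) := by
    have h := ((Comp.const U 1 0 β (1 - ε)).sub hX).smul (B / ε)
    refine h.mono (by norm_num) le_rfl ?_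
    rw [abs_of_nonneg hBε, abs_of_nonneg (by linarith)]
    nlinarith
  have hY0 : 0 ≤ Y := by positivity
  have hYβ : 2 * Y ≤ β := by rw [hY]; linarith
  have hw := w1.min w2 hYβ hY0 one_pos
  have hp := (((y1.min y2 hYβ hY0 one_pos).min hw (by linarith) (by norm_num) (by norm_num)).relu
    (by linarith) (by norm_num))
  have hm := (((y1.neg.min y2.neg hYβ hY0 one_pos).min hw (by linarith) (by norm_num)
    (by norm_num)).relu (by linarith) (by norm_num))
  exact (hp.sub hm).mono (by norm_num) le_rfl (by norm_num)

open scoped Classical in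
/-- The coordinates of a state that depends on a real parameter. -/
noncomputable def signals (s : ℝ → State ι) : Finset (ℝ → ℝ) :=
  Finset.univ.image (fun i t => (s t).weight i) ∪ Finset.univ.image (fun i t => (s t).moment i) ∪
    {fun t => (s t).pos}

lemma card_signals_le (s : ℝ → State ι) : (signals s).card ≤ 2 * Fintype.card ι + 1 := by
  classical
  have h1 : (Finset.univ.image fun (i : ι) (t : ℝ) => (s t).weight i).card ≤ Fintype.card ι :=
    Finset.card_image_le
  have h2 : (Finset.univ.image fun (i : ι) (t : ℝ) => (s t).moment i).card ≤ Fintype.card ι :=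
    Finset.card_image_le
  refine (Finset.card_union_le _ _).trans ?_
  have := Finset.card_union_le (Finset.univ.image fun (i : ι) (t : ℝ) => (s t).weight i)
    (Finset.univ.image fun (i : ι) (t : ℝ) => (s t).moment i)
  rw [Finset.card_singleton]
  omega

lemma weight_mem_signals (s : ℝ → State ι) (i : ι) : (fun t => (s t).weight i) ∈ signals s := by
  simp [signals]

lemma moment_mem_signals (s : ℝ → State ι) (i : ι) : (fun t => (s t).moment i) ∈ signals s := by
  simp [signals]

lemma pos_mem_signals (s : ℝ → State ι) : (fun t => (s t).pos) ∈ signals s := by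
  simp [signals]

lemma forall_mem_signals {P : (ℝ → ℝ) → Prop} {s : ℝ → State ι}
    (hw : ∀ i, P fun t => (s t).weight i) (hm : ∀ i, P fun t => (s t).moment i)
    (hp : P fun t => (s t).pos) : ∀ u ∈ signals s, P u := by
  intro u hu
  simp only [signals, Finset.mem_union, Finset.mem_image, Finset.mem_univ, true_and,
    Finset.mem_singleton] at hu
  rcases hu with (⟨i, rfl⟩ | ⟨i, rfl⟩) | rfl
  exacts [hw i, hm i, hp]

lemma compAll_step (s : ℝ → State ι) (hM : 0 < M)
    (hR : ∀ d j, 2 * M * ∑ i, |T d i j| ≤ R) (hR0 : 0 ≤ R) (hB : 0 ≤ B) (hκ : 0 ≤ κ)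
    (hβ : Fintype.card ι * R + 2 * M + 2 * (B * κ) + 3 * B + 4 ≤ β) :
    CompAll (signals s) ((2 * Fintype.card ι + 1) * (6 * M)) 2 β (2 * M)
      (signals fun t => (s t).step T B κ) := by
  have hM0 : (0 : ℝ) < M := by exact_mod_cast hM
  have hcR : 0 ≤ Fintype.card ι * R := by positivity
  have hTR : ∀ d i j, 2 * M * |T d i j| ≤ R := fun d i j => le_trans
    (mul_le_mul_of_nonneg_left (Finset.single_le_sum (f := fun i => |T d i j|)
      (fun i _ => abs_nonneg _) (Finset.mem_univ i)) (by positivity)) (hR d j)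
  have hd0 : ∀ d : Fin M, (0 : ℝ) ≤ (d : ℕ) := fun d => Nat.cast_nonneg _
  have hd : ∀ d : Fin M, (d : ℝ) ≤ M := fun d => by exact_mod_cast d.2.le
  have hx := pos_mem_signals s
  have hsum : ∀ {y : Fin M → ℝ → ℝ} {Y e : ℝ}, (∀ d, Comp (signals s) 1 0 β Y (y d)) →
      Y ≤ Fintype.card ι * R + 2 * M → |e| ≤ 3 →
      Comp (signals s) (6 * M) 2 β (2 * M)
        fun t => ∑ d : Fin M, gate B (κ * tent M d (s t).pos - e) (y d t) := by
    intro y Y e hy hY he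
    have h := Comp.sum Finset.univ fun d _ =>
      Comp.gate_tent (B := B) (κ := κ) d hx (hy d) hB hκ he (by linarith)
    simp only [Finset.card_univ, Fintype.card_fin] at h
    exact h.mono (by rw [mul_comm]) le_rfl (by rw [mul_comm])
  refine CompAll.mono (CompAll.of_comp two_pos (forall_mem_signals ?_ ?_ ?_))
    (Nat.mul_le_mul_right _ (card_signals_le _)) le_rfl le_rfl
  · intro j
    refine hsum (Y := Fintype.card ι * R) (fun d => ?_) (by linarith) (by norm_num)
    have h := Comp.sum Finset.univ fun i _ => ((Comp.affine (W := 0) (B := β)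
      (AffComb.of_mem (weight_mem_signals s i))).smul (T d i j)).mono le_rfl le_rfl
      (show _ ≤ R by
        have := hTR d i j
        have : (1 : ℝ) ≤ M := by exact_mod_cast hM
        nlinarith [abs_nonneg (T d i j)])
    exact h.mono (by simp) le_rfl le_rfl
  · intro j
    refine hsum (Y := Fintype.card ι * R) (fun d => ?_) (by linarith) (by norm_num)
    have h := Comp.sum Finset.univ fun i _ => ((((Comp.affine (W := 0) (B := β)
      (AffComb.of_mem (moment_mem_signals s i))).smul M).sub ((Comp.affine (W := 0) (B := β)
      (AffComb.of_mem (weight_mem_signals s i))).smul d)).smul (T d i j)).mono le_rfl le_rfl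
      (show _ ≤ R by
        rw [Nat.abs_cast, Nat.abs_cast]
        have := hTR d i j
        nlinarith [abs_nonneg (T d i j), hd d])
    exact h.mono (by simp) le_rfl le_rfl
  · refine hsum (Y := 2 * M) (fun d => ?_) (by linarith) (by norm_num)
    have h := ((Comp.affine (W := 0) (B := β) (AffComb.of_mem hx)).smul M).sub
      (Comp.const (signals s) 1 0 β d)
    refine h.mono (by norm_num) le_rfl ?_
    rw [Nat.abs_cast, Nat.abs_cast]
    linarith [hd d]

open scoped Classical in
/-- The initial state: the weights form a unit vector, and the position is `t - τ`, clamped to the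
unit interval. -/
noncomputable def initState (τ : ℝ) (i : ι) (t : ℝ) : State ι where
  weight j := if j = i then 1 else 0
  moment j := if j = i then 1 - max (1 - max (t - τ) 0) 0 else 0
  pos := 1 - max (1 - max (t - τ) 0) 0

lemma compAll_initState (τ : ℝ) (i : ι) (hβ : 1 + |τ| ≤ β) :
    CompAll {id} (2 * Fintype.card ι + 1) 2 β 2 (signals (initState τ i)) := by
  have hτ := abs_nonneg τ
  have hβ1 : 1 ≤ β := by linarith
  have h0 : Comp {id} 1 0 β (1 + |τ|) fun t => t - τ :=
    ((Comp.affine (W := 0) (B := β) (AffComb.of_mem (Finset.mem_singleton_self id))).sub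
      (Comp.const {id} 1 0 β τ)).mono (by norm_num) le_rfl le_rfl
  have h1 : Comp {id} 1 1 β 1 fun t => max (t - τ) 0 := h0.relu hβ one_pos
  have h2 : Comp {id} 1 1 β 2 fun t => 1 - max (t - τ) 0 := by
    have := (Comp.const {id} 0 1 β 1).sub h1
    exact this.mono (by norm_num) le_rfl (by norm_num)
  have h3 : Comp {id} 1 2 β 2 fun t => 1 - max (1 - max (t - τ) 0) 0 := by
    have h4 : Comp {id} 1 2 β 1 fun t => max (1 - max (t - τ) 0) 0 := by
      -- `1 - max u 0` has coefficients bounded by `1`, although `add` only yields `2`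
      obtain ⟨S, hS, a, b, ha, hb, hab⟩ := h0
      have hS' : Layers 1 β 1 {id} {fun t => max (t - τ) 0} :=
        ⟨S, hS, by simp, fun h hh => ⟨fun t => t - τ, ⟨a, b, fun x => (ha x).trans hβ,
          hb.trans hβ, hab⟩, Finset.mem_singleton.1 hh⟩⟩
      refine Comp.relu ⟨_, hS', fun _ => -1, 1, fun _ => by simp, by simp, fun t => ?_⟩ hβ1 one_pos
      rw [Finset.sum_singleton]
      ring
    have := (Comp.const {id} 0 2 β 1).sub h4
    exact this.mono (by norm_num) le_rfl (by norm_num)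
  have hc : ∀ c : ℝ, |c| ≤ 1 → Comp {id} 1 2 β 2 fun _ => c := fun c hc =>
    (Comp.const {id} 1 2 β c).mono le_rfl le_rfl (by linarith)
  refine CompAll.mono (CompAll.of_comp two_pos (forall_mem_signals ?_ ?_ h3))
    (by rw [mul_one]; exact card_signals_le _) le_rfl le_rfl
  · intro j
    by_cases hj : j = i
    · simpa [initState, hj] using hc 1 (by simp)
    · simpa [initState, hj] using hc 0 (by simp)
  · intro j
    by_cases hj : j = i
    · simpa [initState, hj] using h3
    · simpa [initState, hj] using hc 0 (by simp)

lemma clamp_mem (u : ℝ) : 0 ≤ 1 - max (1 - max u 0) 0 ∧ 1 - max (1 - max u 0) 0 ≤ 1 := by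
  constructor
  · have : max (1 - max u 0) 0 ≤ 1 := max_le (by linarith [le_max_right u 0]) zero_le_one
    linarith
  · linarith [le_max_right (1 - max u 0) 0]

lemma out_iterate_initState {a b c : ℝ} (v : ι → ℝ) (hM : 0 < M)
    (hR1 : 1 ≤ R) (hR : ∀ d j, 2 * M * ∑ i, |T d i j| ≤ R) (hε : 0 < ε)
    (ha : 2 * ε ≤ a) (hab : a < b) (hbc : b < c) (hc : c ≤ 1 - 2 * ε) (hMB : M ≤ B)
    (n : ℕ) (hκ : 4 * (M : ℝ) ^ n ≤ ε * κ) (hB : R ^ n ≤ B) (τ : ℝ) (i : ι) (t : ℝ) :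
    ((State.step T B κ)^[n] (initState τ i t)).out B ε a b c v =
      cell T (fun x i => hat a b c x * v i) n (t - τ) i := by
  obtain ⟨hp0, hp1⟩ := clamp_mem (t - τ)
  rw [State.out_iterate v hM hR1 hR hε ha hab hbc hc hMB n hκ (initState τ i t) hp0 hp1
    (fun j => by by_cases hj : j = i <;> simp [initState, hj])
    (fun j => by
      by_cases hj : j = i
      · simp [initState, hj, abs_of_nonneg hp0]
      · simp [initState, hj]) zero_le_one (by rwa [mul_one])
    (Or.inl fun j => by simp [initState])]
  rw [Finset.sum_eq_single i (fun j _ hj => by simp [initState, hj]) (by simp)]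
  simp only [initState, if_true, one_mul]
  have hF' : ∀ x : ℝ, x ≤ 0 ∨ 1 ≤ x → (fun i => hat a b c x * v i) = 0 := by
    intro x hx
    exact hat_mul_eq_zero v hab hbc (hx.imp (fun h => by linarith) fun h => by linarith)
  rcases le_total (t - τ) 0 with h0 | h0
  · rw [cell_eq_zero_of_notMem hF' n (t - τ) (Or.inl h0), cell_eq_zero_of_notMem hF' n]
    left
    simp [max_eq_right h0]
  rcases le_total (t - τ) 1 with h1 | h1
  · rw [max_eq_left h0, max_eq_left (by linarith), sub_sub_cancel]
  · rw [cell_eq_zero_of_notMem hF' n (t - τ) (Or.inr h1), cell_eq_zero_of_notMem hF' n]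
    right
    rw [max_eq_left h0, max_eq_right (by linarith)]
    norm_num

lemma comp_cell_of_bounds {a b c : ℝ} (v : ι → ℝ) (hM : 0 < M)
    (hR1 : 1 ≤ R) (hR : ∀ d j, 2 * M * ∑ i, |T d i j| ≤ R)
    (ha : 1 / 4 ≤ a) (hab : a < b) (hbc : b < c) (hc : c ≤ 3 / 4) (hMB : M ≤ B)
    (n : ℕ) (hκ : 32 * (M : ℝ) ^ n ≤ κ) (hB : R ^ n ≤ B) (τ : ℝ) (i : ι)
    (hβ1 : Fintype.card ι * R + 2 * M + 2 * (B * κ) + 3 * B + 4 ≤ β)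
    (hβ2 : 4 * (B / (1 / 8)) + 2 * (2 / (b - a) + 2 / (c - b)) + 6 ≤ β) (hβ3 : 1 + |τ| ≤ β) :
    Comp {id} ((2 * Fintype.card ι + 1) * (6 * M) + 32 * Fintype.card ι) (2 * n + 5)
      (((2 * Fintype.card ι + 1) * (2 * M) + 1) * β) (Fintype.card ι * ∑ i, |v i| * 2)
      fun t => cell T (fun x i => hat a b c x * v i) n (t - τ) i := by
  have hM1 : (1 : ℝ) ≤ M := by exact_mod_cast hM
  have hβ0 : 0 ≤ β := by linarith [abs_nonneg τ]
  have hB0 : 0 ≤ B := by linarith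
  have hκ0 : 0 ≤ κ := le_trans (by positivity) hκ
  have hba : 0 < 2 / (b - a) := div_pos two_pos (by linarith)
  have hcb : 0 < 2 / (c - b) := div_pos two_pos (by linarith)
  set ν : ℕ := Fintype.card ι with hν
  have hβ' : ∀ s : ℝ → State ι, (signals s).card * (β * (2 * M)) + β ≤
      ((2 * ν + 1) * (2 * M) + 1) * β := by
    intro s
    have h : ((signals s).card : ℝ) ≤ 2 * ν + 1 := by exact_mod_cast card_signals_le s
    have : ((signals s).card : ℝ) * (β * (2 * M)) ≤ (2 * ν + 1) * (β * (2 * M)) :=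
      mul_le_mul_of_nonneg_right h (by positivity)
    linarith
  have hβG : β ≤ ((2 * ν + 1) * (2 * M) + 1) * β := by
    have : 0 ≤ (2 * (ν : ℝ) + 1) * (2 * M) * β := by positivity
    linarith
  set W : ℕ := (2 * ν + 1) * (6 * M) + 32 * ν with hW
  have hsteps : ∀ k, CompAll {id} W (2 * k + 2) (((2 * ν + 1) * (2 * M) + 1) * β) (2 * M)
      (signals fun t => (State.step T B κ)^[k] (initState τ i t)) := by
    intro k
    induction k with
    | zero =>
      refine (compAll_initState τ i hβ3).mono ?_ hβG (by linarith)
      exact (Nat.le_mul_of_pos_right _ (by omega)).trans (Nat.le_add_right _ _)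
    | succ k ih =>
      have h := ih.comp ((compAll_step _ hM hR (by linarith) hB0 hκ0 hβ1).mono
        (Nat.le_add_right _ _) le_rfl le_rfl) (by positivity) hβ0 (hβ' _)
      simp only [Function.iterate_succ_apply']
      exact h
  have hfin := Comp.sum Finset.univ fun j _ => ((Comp.readout
    (weight_mem_signals (fun t => (State.step T B κ)^[n] (initState τ i t)) j)
    (moment_mem_signals _ j) (pos_mem_signals _) hB0 (by norm_num : (0 : ℝ) < 1 / 8) (by norm_num)
    (abs_le.2 ⟨by linarith, by linarith⟩) (abs_le.2 ⟨by linarith, by linarith⟩) hab hbc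
    (le_add_of_nonneg_right hcb.le) (le_add_of_nonneg_left hba.le) hβ2).smul (v j)).mono
      le_rfl le_rfl (Finset.single_le_sum (f := fun j => |v j| * 2) (fun j _ => by positivity)
        (Finset.mem_univ j))
  have hout : (fun t => ∑ j, v j * hatReadout B (1 / 8) a b c
      (((State.step T B κ)^[n] (initState τ i t)).weight j)
      (((State.step T B κ)^[n] (initState τ i t)).moment j)
      ((State.step T B κ)^[n] (initState τ i t)).pos) =
      fun t => cell T (fun x i => hat a b c x * v i) n (t - τ) i :=
    funext fun t => out_iterate_initState v hM hR1 hR (by norm_num : (0 : ℝ) < 1 / 8) (by linarith)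
      hab hbc (by linarith) hMB n (by linarith) hB τ i t
  rw [hout, Finset.card_univ, ← hν] at hfin
  have hWfin : ∀ u : ℝ → ℝ, ({u} : Finset (ℝ → ℝ)).card * (ν * 32) ≤ W := fun u => by
    rw [Finset.card_singleton, one_mul, mul_comm]
    exact Nat.le_add_left _ _
  obtain ⟨S, hS, hS'⟩ := (hsteps n).comp (CompAll.mono (CompAll.of_comp
    (V := {fun t => cell T (fun x i => hat a b c x * v i) n (t - τ) i}) (by norm_num : 0 < 3)
    (fun u hu => by
      rw [Finset.mem_singleton] at hu
      rw [hu]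
      exact hfin)) (hWfin _) le_rfl le_rfl) (by positivity) hβ0 (hβ' _)
  exact ⟨S, hS, hS' _ (Finset.mem_singleton_self _)⟩

/-- The refinements of a hat in the interior of the unit interval are computed by networks whose
width does not depend on the refinement matrices, and whose weights grow exponentially. -/
theorem exists_comp_cell (hM : 1 ≤ M) (T : Fin M → Matrix ι ι ℝ) (v : ι → ℝ) {a b c : ℝ}
    (ha : 1 / 4 ≤ a) (hab : a < b) (hbc : b < c) (hc : c ≤ 3 / 4) (τ₀ : ℝ) (hτ₀ : 0 ≤ τ₀) :
    ∃ C Λ : ℝ, 1 ≤ C ∧ 1 ≤ Λ ∧ ∀ n, ∀ τ, |τ| ≤ τ₀ → ∀ i,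
      Comp {id} ((2 * Fintype.card ι + 1) * (6 * M) + 32 * Fintype.card ι) (2 * n + 5)
        (C * Λ ^ n) C fun t => cell T (fun x i => hat a b c x * v i) n (t - τ) i := by
  have hM1 : (1 : ℝ) ≤ M := by exact_mod_cast hM
  set R : ℝ := M + 2 * M * ∑ d, ∑ j, ∑ i, |T d i j| with hR
  have hR1 : (M : ℝ) ≤ R := by
    have : 0 ≤ 2 * M * ∑ d, ∑ j, ∑ i, |T d i j| := by positivity
    linarith
  have hTR : ∀ d j, 2 * M * ∑ i, |T d i j| ≤ R := by
    intro d j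
    have h1 : ∑ i, |T d i j| ≤ ∑ j, ∑ i, |T d i j| :=
      Finset.single_le_sum (f := fun j => ∑ i, |T d i j|)
        (fun j _ => Finset.sum_nonneg fun i _ => abs_nonneg _) (Finset.mem_univ j)
    have h2 : ∑ j, ∑ i, |T d i j| ≤ ∑ d, ∑ j, ∑ i, |T d i j| :=
      Finset.single_le_sum (f := fun d => ∑ j, ∑ i, |T d i j|)
        (fun d _ => Finset.sum_nonneg fun j _ => Finset.sum_nonneg fun i _ => abs_nonneg _)
        (Finset.mem_univ d)
    have := mul_le_mul_of_nonneg_left (h1.trans h2) (by positivity : (0 : ℝ) ≤ 2 * M)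
    linarith
  clear_value R
  have hR0 : 1 ≤ R := hM1.trans hR1
  have hba : 0 < 2 / (b - a) := div_pos two_pos (by linarith)
  have hcb : 0 < 2 / (c - b) := div_pos two_pos (by linarith)
  have hK : 0 ≤ 2 / (b - a) + 2 / (c - b) := by linarith
  have hνR : 0 ≤ Fintype.card ι * R := by positivity
  set Q : ℝ := Fintype.card ι * R + 2 * M + 99 * R + 2 * (2 / (b - a) + 2 / (c - b)) + 10 + τ₀
    with hQ
  have hQ1 : 1 ≤ Q := by linarith
  set Co : ℝ := Fintype.card ι * (∑ i, |v i| * 2) with hCo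
  have hCo0 : 0 ≤ Co := by positivity
  set G : ℝ := (2 * Fintype.card ι + 1) * (2 * M) + 1 with hG
  have hG1 : 1 ≤ G := le_add_of_nonneg_left (by positivity)
  have hGQ : 1 ≤ G * Q := one_le_mul_of_one_le_of_one_le hG1 hQ1
  refine ⟨G * Q + Co, R * M, by linarith, one_le_mul_of_one_le_of_one_le hR0 hM1, ?_⟩
  intro n τ hτ i
  have hMn : 1 ≤ (M : ℝ) ^ n := one_le_pow₀ hM1
  set P : ℝ := (R * M) ^ n with hP
  have hP1 : 1 ≤ P := one_le_pow₀ (one_le_mul_of_one_le_of_one_le hR0 hM1)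
  have hle : ∀ {x : ℝ}, 0 ≤ x → x ≤ x * P := fun hx => le_mul_of_one_le_right hx hP1
  have hB0 : 0 ≤ R ^ (n + 1) := by positivity
  have hBle : R ^ (n + 1) ≤ R * P := by
    rw [hP, pow_succ', mul_pow]
    exact mul_le_mul_of_nonneg_left (le_mul_of_one_le_right (by positivity) hMn) (by positivity)
  have hBκ : R ^ (n + 1) * (32 * (M : ℝ) ^ n) = 32 * R * P := by
    rw [hP, mul_pow]; ring
  have hMB : (M : ℝ) ≤ R ^ (n + 1) := hR1.trans (le_self_pow₀ hR0 (by omega))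
  have h := comp_cell_of_bounds (T := T) (β := Q * P) v hM hR0 hTR ha hab hbc hc hMB n le_rfl
    (pow_le_pow_right₀ hR0 (by omega)) τ i
    (by
      have h1 := hle (show 0 ≤ Fintype.card ι * R + 2 * M + 4 by positivity)
      have h2 : (Fintype.card ι * R + 2 * M + 4 + 64 * R + 3 * R) * P ≤ Q * P :=
        mul_le_mul_of_nonneg_right (by linarith) (by linarith)
      linarith)
    (by
      have h1 := hle (show 0 ≤ 2 * (2 / (b - a) + 2 / (c - b)) + 6 by linarith)
      have h2 : (32 * R + (2 * (2 / (b - a) + 2 / (c - b)) + 6)) * P ≤ Q * P :=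
        mul_le_mul_of_nonneg_right (by linarith) (by linarith)
      linarith)
    (by
      have h1 := hle (show 0 ≤ Q by linarith)
      linarith)
  refine h.mono le_rfl ?_ (by linarith)
  rw [← mul_assoc]
  exact mul_le_mul_of_nonneg_right (by linarith) (by linarith)

end Network

/-! ### Hats and piecewise linear curves -/

lemma hat_of_mem_left {a b c x : ℝ} (hab : a < b) (hbc : b < c) (h1 : a ≤ x) (h2 : x ≤ b) :
    hat a b c x = (x - a) / (b - a) := by
  have h3 : 0 ≤ (x - a) / (b - a) := div_nonneg (by linarith) (by linarith)
  have h4 : (x - a) / (b - a) ≤ 1 := (div_le_one (by linarith)).2 (by linarith)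
  have h5 : 1 ≤ (c - x) / (c - b) := (one_le_div (by linarith)).2 (by linarith)
  rw [hat, min_eq_left (h4.trans h5), max_eq_left h3]

lemma hat_of_mem_right {a b c x : ℝ} (hab : a < b) (hbc : b < c) (h1 : b ≤ x) (h2 : x ≤ c) :
    hat a b c x = (c - x) / (c - b) := by
  have h3 : 0 ≤ (c - x) / (c - b) := div_nonneg (by linarith) (by linarith)
  have h4 : (c - x) / (c - b) ≤ 1 := (div_le_one (by linarith)).2 (by linarith)
  have h5 : 1 ≤ (x - a) / (b - a) := (one_le_div (by linarith)).2 (by linarith)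
  rw [hat, min_eq_right (h4.trans h5), max_eq_left h3]

lemma continuous_hat (a b c : ℝ) : Continuous (hat a b c) := by
  unfold hat
  fun_prop

lemma breakpoints_hat_subset {p : ℕ} {a b c : ℝ} (hab : a < b) (hbc : b < c) (v : Fin p → ℝ) :
    breakpoints (fun t => hat a b c t • v) ⊆ {a, b, c} := by
  intro t ht
  by_contra hmem
  simp only [mem_insert_iff, mem_singleton_iff, not_or] at hmem
  obtain ⟨h1, h2, h3⟩ := hmem
  refine ht ?_
  rcases lt_or_gt_of_ne h1 with h | ha
  · refine ⟨0, 0, ?_⟩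
    filter_upwards [Iio_mem_nhds h] with s hs
    simp [hat_eq_zero_of_le hab (le_of_lt hs)]
  rcases lt_or_gt_of_ne h2 with h | hb
  · refine ⟨(1 / (b - a)) • v, (-a / (b - a)) • v, ?_⟩
    filter_upwards [Ioo_mem_nhds ha h] with s hs
    rw [hat_of_mem_left hab hbc hs.1.le hs.2.le, smul_smul, ← add_smul]
    congr 1
    ring
  rcases lt_or_gt_of_ne h3 with h | hc
  · refine ⟨(-1 / (c - b)) • v, (c / (c - b)) • v, ?_⟩
    filter_upwards [Ioo_mem_nhds hb h] with s hs
    rw [hat_of_mem_right hab hbc hs.1.le hs.2.le, smul_smul, ← add_smul]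
    congr 1
    ring
  · refine ⟨0, 0, ?_⟩
    filter_upwards [Ioi_mem_nhds hc] with s hs
    simp [hat_eq_zero_of_ge hbc (le_of_lt hs)]

lemma isCPwL_hat {p : ℕ} {a b c : ℝ} (hab : a < b) (hbc : b < c) (v : Fin p → ℝ) :
    IsCPwL fun t => hat a b c t • v where
  continuous := (continuous_hat a b c).smul continuous_const
  finite_breakpoints _ _ :=
    ((Set.toFinite {a, b, c}).subset (breakpoints_hat_subset hab hbc v)).inter_of_left _

lemma tsupport_hat_subset {p : ℕ} {a b c : ℝ} (hab : a < b) (hbc : b < c) (v : Fin p → ℝ) :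
    tsupport (fun t => hat a b c t • v) ⊆ Icc a c := by
  refine closure_minimal (fun t ht => ?_) isClosed_Icc
  by_contra h
  refine ht ?_
  rcases not_and_or.1 h with h | h
  · simp [hat_eq_zero_of_le hab (le_of_not_ge h)]
  · simp [hat_eq_zero_of_ge hbc (le_of_not_ge h)]

/-- A continuous curve without breakpoints in `(a, b)` is affine on `[a, b]`. -/
lemma eq_interpolation_of_no_breakpoints {p : ℕ} {f : ℝ → Fin p → ℝ} (hf : Continuous f) {a b : ℝ}
    (hab : a < b) (h : ∀ x ∈ Ioo a b, x ∉ breakpoints f) {t : ℝ} (ht : t ∈ Icc a b) :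
    f t = ((b - t) / (b - a)) • f a + ((t - a) / (b - a)) • f b := by
  have hloc : ∀ x ∈ Ioo a b, ∃ α β : Fin p → ℝ, ∀ᶠ s in 𝓝 x, f s = β + s • α := fun x hx =>
    not_not.1 (h x hx)
  have hder : ∀ (α β : Fin p → ℝ) (s : ℝ), HasDerivAt (fun s : ℝ => β + s • α) α s := by
    intro α β s
    simpa using ((hasDerivAt_id s).smul_const α).const_add β
  have hdf : ∀ x ∈ Ioo a b, DifferentiableAt ℝ f x ∧ DifferentiableAt ℝ (deriv f) x ∧
      deriv (deriv f) x = 0 := by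
    intro x hx
    obtain ⟨α, β, hαβ⟩ := hloc x hx
    have h1 : f =ᶠ[𝓝 x] fun s => β + s • α := hαβ
    have h2 : deriv f =ᶠ[𝓝 x] fun _ => α :=
      h1.deriv.trans (Eventually.of_forall fun s => (hder α β s).deriv)
    exact ⟨((hder α β x).congr_of_eventuallyEq h1).differentiableAt,
      h2.differentiableAt_iff.2 (differentiableAt_const _), by rw [h2.deriv_eq]; simp⟩
  set x₀ := (a + b) / 2 with hx₀
  have hx₀mem : x₀ ∈ Ioo a b := ⟨by linarith, by linarith⟩
  set α := deriv f x₀ with hα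
  have hconst : ∀ x ∈ Ioo a b, deriv f x = α := fun x hx =>
    isOpen_Ioo.is_const_of_deriv_eq_zero isPreconnected_Ioo
      (fun y hy => (hdf y hy).2.1.differentiableWithinAt) (fun y hy => (hdf y hy).2.2) hx hx₀mem
  have hg : ∀ x ∈ Ioo a b, HasDerivAt (fun s => f s - s • α) 0 x := by
    intro x hx
    have h1 : HasDerivAt (fun s => f s - s • α) (deriv f x - (1 : ℝ) • α) x :=
      (hdf x hx).1.hasDerivAt.sub ((hasDerivAt_id x).smul_const α)
    rwa [hconst x hx, one_smul, sub_self] at h1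
  set β := f x₀ - x₀ • α with hβ
  have hopen : EqOn f (fun s => β + s • α) (Ioo a b) := by
    intro x hx
    have := isOpen_Ioo.is_const_of_deriv_eq_zero isPreconnected_Ioo
      (fun y hy => (hg y hy).differentiableAt.differentiableWithinAt)
      (fun y hy => (hg y hy).deriv) hx hx₀mem
    rw [hβ, ← this]
    simp
  have hclosed : EqOn f (fun s => β + s • α) (Icc a b) := by
    rw [← closure_Ioo hab.ne]
    exact hopen.closure hf (by fun_prop)
  rw [hclosed ht, hclosed (left_mem_Icc.2 hab.le), hclosed (right_mem_Icc.2 hab.le)]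
  have hne : b - a ≠ 0 := by linarith
  funext i
  simp only [Pi.add_apply, Pi.smul_apply, smul_eq_mul]
  field_simp
  ring

lemma exists_mem_Icc_succ (s : ℕ → ℝ) (k : ℕ) {t : ℝ} (h0 : s 0 ≤ t) (h1 : t ≤ s (k + 1)) :
    ∃ j ≤ k, s j ≤ t ∧ t ≤ s (j + 1) := by
  induction k with
  | zero => exact ⟨0, le_rfl, h0, h1⟩
  | succ k ih =>
    rcases le_total t (s (k + 1)) with h | h
    · obtain ⟨j, hj, h2⟩ := ih h
      exact ⟨j, by omega, h2⟩
    · exact ⟨k + 1, le_rfl, h, h1⟩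

/-- A curve that is affine between the nodes `s 0, …, s (k + 1)`, and zero outside, is the
combination of the hats centred at the interior nodes. -/
lemma eq_sum_hat {p : ℕ} {f : ℝ → Fin p → ℝ} {s : ℕ → ℝ} (hs : StrictMono s) (k : ℕ)
    (hf : ∀ i ≤ k, ∀ t ∈ Icc (s i) (s (i + 1)), f t =
      ((s (i + 1) - t) / (s (i + 1) - s i)) • f (s i) +
        ((t - s i) / (s (i + 1) - s i)) • f (s (i + 1)))
    (h0 : ∀ t ≤ s 0, f t = 0) (h1 : ∀ t, s (k + 1) ≤ t → f t = 0) (t : ℝ) :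
    f t = ∑ i ∈ Finset.range k, hat (s i) (s (i + 1)) (s (i + 2)) t • f (s (i + 1)) := by
  have hlt : ∀ i, s i < s (i + 1) := fun i => hs (Nat.lt_succ_self i)
  rcases le_total t (s 0) with ht0 | ht0
  · rw [h0 t ht0, Finset.sum_eq_zero]
    intro i _
    rw [hat_eq_zero_of_le (hlt i) (ht0.trans (hs.monotone (Nat.zero_le i))), zero_smul]
  rcases le_total (s (k + 1)) t with ht1 | ht1
  · rw [h1 t ht1, Finset.sum_eq_zero]
    intro i hi
    have := Finset.mem_range.1 hi
    rw [hat_eq_zero_of_ge (hlt (i + 1)) ((hs.monotone (by omega : i + 2 ≤ k + 1)).trans ht1),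
      zero_smul]
  obtain ⟨j, hj, hj1, hj2⟩ := exists_mem_Icc_succ s k ht0 ht1
  have hzero : ∀ i, i + 1 < j ∨ j < i →
      hat (s i) (s (i + 1)) (s (i + 2)) t • f (s (i + 1)) = 0 := by
    rintro i (hi | hi)
    · rw [hat_eq_zero_of_ge (hlt (i + 1)) ((hs.monotone (by omega : i + 2 ≤ j)).trans hj1),
        zero_smul]
    · rw [hat_eq_zero_of_le (hlt i) (hj2.trans (hs.monotone (by omega : j + 1 ≤ i))), zero_smul]
  have hlast : j ∉ Finset.range k →
      hat (s j) (s (j + 1)) (s (j + 2)) t • f (s (j + 1)) = 0 := by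
    intro h
    obtain rfl : j = k := by
      have := Finset.mem_range.not.1 h
      omega
    rw [h1 _ le_rfl, smul_zero]
  rw [hf j hj t ⟨hj1, hj2⟩]
  rcases j with _ | j
  · rw [h0 _ le_rfl, smul_zero, zero_add, Finset.sum_eq_single 0
      (fun i _ hi => hzero i (Or.inr (Nat.pos_of_ne_zero hi))) hlast,
      hat_of_mem_left (hlt 0) (hlt 1) hj1 hj2]
  · rw [Finset.sum_eq_add j (j + 1) (by omega) (fun i _ hi => hzero i (by omega))
      (fun h => absurd (Finset.mem_range.2 (by omega)) h) hlast,
      hat_of_mem_right (hlt j) (hlt (j + 1)) hj1 hj2,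
      hat_of_mem_left (hlt (j + 1)) (hlt (j + 2)) hj1 hj2]

/-- The elements of a finite set in increasing order, continued to a strictly increasing
sequence. -/
lemma Finset.exists_strictMono_enum (N : Finset ℝ) :
    ∃ s : ℕ → ℝ, StrictMono s ∧ (∀ i < N.card, s i ∈ N) ∧ ∀ x ∈ N, ∃ i < N.card, s i = x := by
  obtain ⟨b, hb⟩ := N.bddAbove
  refine ⟨fun i => if h : i < N.card then N.orderEmbOfFin rfl ⟨i, h⟩ else b + 1 + i, ?_, ?_, ?_⟩
  · intro i j hij
    by_cases hj : j < N.card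
    · have hi : i < N.card := hij.trans hj
      simpa [hi, hj] using hij
    · by_cases hi : i < N.card
      · simp only [hi, hj, dif_pos, dif_neg, not_false_iff]
        have := hb (N.orderEmbOfFin_mem rfl ⟨i, hi⟩)
        have hj0 : (0 : ℝ) ≤ j := Nat.cast_nonneg _
        linarith
      · simpa [hi, hj] using hij
  · intro i hi
    simp [hi]
  · intro x hx
    have : x ∈ Set.range (N.orderEmbOfFin rfl) := by
      rw [Finset.range_orderEmbOfFin]
      exact hx
    obtain ⟨i, rfl⟩ := this
    exact ⟨i, i.2, by simp⟩

lemma eq_zero_of_tsupport_subset {p : ℕ} {f : ℝ → Fin p → ℝ} (hf : Continuous f) {a b : ℝ}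
    (h : tsupport f ⊆ Icc a b) : (∀ t ≤ a, f t = 0) ∧ ∀ t, b ≤ t → f t = 0 := by
  have hout : ∀ t, t ∉ Icc a b → f t = 0 := fun t ht => image_eq_zero_of_notMem_tsupport
    fun h' => ht (h h')
  constructor
  · intro t ht
    have h1 : EqOn f (fun _ => 0) (Iio a) := fun x hx => hout x fun h' => not_le.2 hx h'.1
    have h2 := h1.closure hf continuous_const
    rw [closure_Iio] at h2
    exact h2 ht
  · intro t ht
    have h1 : EqOn f (fun _ => 0) (Ioi b) := fun x hx => hout x fun h' => not_le.2 hx h'.2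
    have h2 := h1.closure hf continuous_const
    rw [closure_Ioi] at h2
    exact h2 ht

/-- A curve with few breakpoints is a combination of few hats of length at most `1 / 2`. -/
lemma exists_eq_sum_hat {p m L : ℕ} (hL : 1 ≤ L) {γ : ℝ → Fin p → ℝ} (hγ : Continuous γ)
    (hsupp : tsupport γ ⊆ Icc 0 (L : ℝ)) (hm : (breakpoints γ).encard ≤ m) :
    ∃ k ≤ m + 4 * L, ∃ (s : ℕ → ℝ) (v : ℕ → Fin p → ℝ), StrictMono s ∧
      (∀ i < k, 0 ≤ s i ∧ s i ≤ L ∧ s (i + 2) ≤ s i + 1 / 2) ∧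
      ∀ t, γ t = ∑ i ∈ Finset.range k, hat (s i) (s (i + 1)) (s (i + 2)) t • v i := by
  classical
  have hfin : (breakpoints γ).Finite := Set.finite_of_encard_le_coe hm
  obtain ⟨hz0, hz1⟩ := eq_zero_of_tsupport_subset hγ hsupp
  set grid : Finset ℝ := (Finset.range (4 * L + 1)).image fun i : ℕ => (i : ℝ) / 4 with hgrid
  set N : Finset ℝ := grid ∪ hfin.toFinset.filter fun x => x ∈ Icc 0 (L : ℝ) with hN
  have hNmem : ∀ x ∈ N, 0 ≤ x ∧ x ≤ L := by
    intro x hx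
    rcases Finset.mem_union.1 hx with hx | hx
    · obtain ⟨i, hi, rfl⟩ := Finset.mem_image.1 hx
      have : (i : ℝ) ≤ 4 * L := by exact_mod_cast Nat.lt_succ_iff.1 (Finset.mem_range.1 hi)
      exact ⟨by positivity, by linarith⟩
    · exact (Finset.mem_filter.1 hx).2
  have hgridN : ∀ i : ℕ, i ≤ 4 * L → (i : ℝ) / 4 ∈ N := fun i hi =>
    Finset.mem_union_left _ (Finset.mem_image_of_mem _ (Finset.mem_range.2 (by omega)))
  have hcard : N.card ≤ m + 4 * L + 1 := by
    have h1 : grid.card ≤ 4 * L + 1 := Finset.card_image_le.trans (by simp)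
    have h2 : hfin.toFinset.card ≤ m := by
      rw [hfin.encard_eq_coe_toFinset_card] at hm
      exact_mod_cast hm
    have h3 : N.card ≤ grid.card + hfin.toFinset.card := (Finset.card_union_le _ _).trans
      (Nat.add_le_add_left (Finset.card_filter_le _ _) _)
    omega
  have hzeroN : (0 : ℝ) ∈ N := by simpa using hgridN 0 (by omega)
  have hLN : (L : ℝ) ∈ N := by
    have := hgridN (4 * L) le_rfl
    push_cast at this
    rwa [mul_div_cancel_left₀ _ (by norm_num : (4 : ℝ) ≠ 0)] at this
  have hLpos : (0 : ℝ) < L := by exact_mod_cast hL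
  have hcard2 : 2 ≤ N.card :=
    Finset.one_lt_card.2 ⟨0, hzeroN, L, hLN, hLpos.ne⟩
  obtain ⟨k, hk⟩ : ∃ k, N.card = k + 2 := ⟨N.card - 2, by omega⟩
  obtain ⟨s, hs, hsN, hNs⟩ := N.exists_strictMono_enum
  rw [hk] at hsN hNs
  have hs0 : s 0 = 0 := by
    obtain ⟨i, _, hi⟩ := hNs 0 hzeroN
    exact le_antisymm (hi ▸ hs.monotone (Nat.zero_le i)) (hNmem _ (hsN 0 (by omega))).1
  have hsk : s (k + 1) = L := by
    obtain ⟨i, hik, hi⟩ := hNs L hLN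
    exact le_antisymm (hNmem _ (hsN (k + 1) (by omega))).2
      (hi ▸ hs.monotone (by omega : i ≤ k + 1))
  have hgap : ∀ i, ∀ x ∈ Ioo (s i) (s (i + 1)), x ∉ N := by
    rintro i x ⟨h1, h2⟩ hx
    obtain ⟨j, _, rfl⟩ := hNs x hx
    have := hs.lt_iff_lt.1 h1
    have := hs.lt_iff_lt.1 h2
    omega
  have hmesh : ∀ i ≤ k, s (i + 1) ≤ s i + 1 / 4 := by
    intro i hi
    by_contra! hcon
    have hsi : 0 ≤ 4 * s i := by linarith [(hNmem _ (hsN i (by omega))).1]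
    have hsi1 := (hNmem _ (hsN (i + 1) (by omega))).2
    have h1 := Nat.lt_floor_add_one (4 * s i)
    have h2 := Nat.floor_le hsi
    have h3 : (((⌊4 * s i⌋₊ + 1 : ℕ) : ℝ)) / 4 ∈ Ioo (s i) (s (i + 1)) := by
      push_cast
      exact ⟨by linarith, by linarith⟩
    refine hgap i _ h3 (hgridN _ ?_)
    have h4 : ((⌊4 * s i⌋₊ + 1 : ℕ) : ℝ) ≤ ((4 * L : ℕ) : ℝ) := by
      push_cast
      linarith
    exact_mod_cast h4
  refine ⟨k, by omega, s, fun i => γ (s (i + 1)), hs, fun i hi => ?_, fun t => ?_⟩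
  · refine ⟨(hNmem _ (hsN i (by omega))).1, (hNmem _ (hsN i (by omega))).2, ?_⟩
    linarith [hmesh i (by omega), hmesh (i + 1) (by omega)]
  · refine eq_sum_hat hs k (fun i hi t ht => ?_) (fun t ht => hz0 t (hs0 ▸ ht))
      (fun t ht => hz1 t (hsk ▸ ht)) t
    refine eq_interpolation_of_no_breakpoints hγ (hs (Nat.lt_succ_self i)) (fun x hx hb => ?_) ht
    refine hgap i x hx (Finset.mem_union_right _ (Finset.mem_filter.2
      ⟨hfin.mem_toFinset.2 hb, ?_⟩))
    exact ⟨(hNmem _ (hsN i (by omega))).1.trans hx.1.le,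
      hx.2.le.trans (hNmem _ (hsN (i + 1) (by omega))).2⟩

/-! ### The refinement operator -/

section Refine

variable {M p L : ℕ} {A : ℤ →₀ Matrix (Fin p) (Fin p) ℝ}

/-- The refinement of a short hat near one end of the window contains disjoint scaled copies of
the columns of all `A j`, so a refinement operator that preserves the window has a short mask. -/
lemma PreservesWindow.mask_eq_zero (hM : 2 ≤ M) (hL : 1 ≤ L) (hA : PreservesWindow M L A) (j : ℤ)
    (hj : A j ≠ 0) : 0 ≤ j ∧ j ≤ (M - 1) * L := by
  have hM0 : (0 : ℝ) < M := by exact_mod_cast (by omega : 0 < M)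
  have hL1 : (1 : ℝ) ≤ L := by exact_mod_cast hL
  obtain ⟨v, hv⟩ : ∃ v, (A j).mulVec v ≠ 0 := by
    by_contra! h
    refine hj (Matrix.ext fun i i' => ?_)
    have := congrFun (h (Pi.single i' 1)) i
    simpa using this
  have key : ∀ x : ℝ, 1 / 4 ≤ x → x ≤ L - 1 / 4 → (j + x) / M ∈ Icc 0 (L : ℝ) := by
    intro x hx0 hx1
    have h1 : x - 1 / 4 < x := by linarith
    have h2 : x < x + 1 / 4 := by linarith
    have hsub : Icc (x - 1 / 4) (x + 1 / 4) ⊆ Icc 0 (L : ℝ) :=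
      Icc_subset_Icc (by linarith) (by linarith)
    have htsupp := tsupport_hat_subset h1 h2 v
    refine hA _ (isCPwL_hat h1 h2 v)
      (HasCompactSupport.of_support_subset_isCompact isCompact_Icc
        ((subset_tsupport _).trans htsupp)) (htsupp.trans hsub) (subset_tsupport _ ?_)
    have e : refine M A (fun t => hat (x - 1 / 4) x (x + 1 / 4) t • v) ((j + x) / M) =
        (A j).mulVec v := by
      rw [refine, Finsupp.sum, Finset.sum_eq_single j]
      · rw [mul_div_cancel₀ _ hM0.ne', add_sub_cancel_left, hat_of_mem_left h1 h2 h1.le le_rfl,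
          div_self (by norm_num), one_smul]
      · intro i _ hi
        rw [mul_div_cancel₀ _ hM0.ne']
        rcases lt_or_gt_of_ne hi with h | h
        · have : (i : ℝ) + 1 ≤ j := by exact_mod_cast h
          rw [hat_eq_zero_of_ge h2 (by linarith), zero_smul, Matrix.mulVec_zero]
        · have : (j : ℝ) + 1 ≤ i := by exact_mod_cast h
          rw [hat_eq_zero_of_le h1 (by linarith), zero_smul, Matrix.mulVec_zero]
      · intro h
        rw [Finsupp.notMem_support_iff.1 h, Matrix.zero_mulVec]
    rw [Function.mem_support, e]
    exact hv
  constructor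
  · have h := (key (1 / 4) le_rfl (by linarith)).1
    rw [le_div_iff₀ hM0, zero_mul] at h
    have : (-1 : ℝ) < j := by linarith
    have : (-1 : ℤ) < j := by exact_mod_cast this
    omega
  · have h := (key (L - 1 / 4) (by linarith) le_rfl).2
    rw [div_le_iff₀ hM0] at h
    have : (j : ℝ) < (M - 1) * L + 1 := by linarith
    have : j < (M - 1) * L + 1 := by exact_mod_cast this
    omega

lemma iterate_refine_comp_sub (γ : ℝ → Fin p → ℝ) (hM : M ≠ 0) (θ : ℝ) (n : ℕ) :
    (refine M A)^[n] (fun t => γ (t - θ)) = fun t => (refine M A)^[n] γ (t - θ / M ^ n) := by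
  have hM0 : (M : ℝ) ≠ 0 := by exact_mod_cast hM
  induction n with
  | zero => simp
  | succ n ih =>
    simp only [Function.iterate_succ_apply', ih]
    funext t
    simp only [refine]
    have e : ∀ j : ℤ, (M : ℝ) * t - j - θ / M ^ n = M * (t - θ / M ^ (n + 1)) - j := by
      intro j
      rw [pow_succ]
      field_simp
      ring
    simp only [e]

lemma iterate_refine_sum {κ : Type*} (s : Finset κ) (γ : κ → ℝ → Fin p → ℝ) (n : ℕ) :
    (refine M A)^[n] (fun t => ∑ i ∈ s, γ i t) = fun t => ∑ i ∈ s, (refine M A)^[n] (γ i) t := by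
  induction n with
  | zero => rfl
  | succ n ih =>
    simp only [Function.iterate_succ_apply', ih]
    funext t
    simp only [refine, Finsupp.sum, Matrix.mulVec_sum]
    exact Finset.sum_comm

/-- The matrices of the vectorized refinement operator: the `(r, l)` block of the `d`-th one is
`A (d + M r - l)`. -/
def blockMatrix (M L : ℕ) (A : ℤ →₀ Matrix (Fin p) (Fin p) ℝ) (d : Fin M) :
    Matrix (Fin L × Fin p) (Fin L × Fin p) ℝ :=
  fun i j => A (d + M * i.1 - j.1) i.2 j.2

/-- The curve `V ^ n (η v)` is assembled from the vectorized refinements, one block for each of the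
`L` unit intervals in the window. -/
lemma iterate_refine_eq_sum_cell (hL : 0 < L)
    (hA : ∀ j, A j ≠ 0 → 0 ≤ j ∧ j ≤ (M - 1) * L) (η : ℝ → ℝ) (v : Fin p → ℝ) (n : ℕ) (t : ℝ)
    (c : Fin p) :
    (refine M A)^[n] (fun t => η t • v) t c = ∑ r : Fin L,
      cell (blockMatrix M L A) (fun x i => η x * if (i.1 : ℕ) = 0 then v i.2 else 0) n (t - r)
        (r, c) := by
  induction n generalizing t c with
  | zero =>
    rw [Finset.sum_eq_single ⟨0, hL⟩]
    · simp [cell]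
    · intro r _ hr
      have : (r : ℕ) ≠ 0 := fun h => hr (Fin.ext h)
      simp [cell, this]
    · simp
  | succ n ih =>
    set F := cell (blockMatrix M L A)
      (fun x i => η x * if (i.1 : ℕ) = 0 then v i.2 else 0) n with hF
    have hmask : ∀ (l : Fin L) (X : ℤ → ℝ), (∀ j, A j = 0 → X j = 0) →
        ∑ j ∈ A.support, X j = ∑ r : Fin L, ∑ d : Fin M, X (d + M * r - l) := by
      intro l X hX
      have h1 : ∑ r : Fin L, ∑ d : Fin M, X (d + M * r - l) =
          ∑ s : Fin (L * M), X ((s : ℕ) - (l : ℕ)) := by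
        rw [← finProdFinEquiv.sum_comp, Fintype.sum_prod_type]
        simp [finProdFinEquiv]
      rw [h1, Fin.sum_univ_eq_sum_range (fun s : ℕ => X ((s : ℤ) - (l : ℕ))),
        ← Finset.sum_image (g := fun s : ℕ => (s : ℤ) - (l : ℕ)) (f := X)
          (by intro a _ b _ h; simpa using h)]
      refine Finset.sum_subset (fun j hj => ?_) fun j _ hj => hX j (Finsupp.notMem_support_iff.1 hj)
      obtain ⟨h2, h3⟩ := hA j (Finsupp.mem_support_iff.1 hj)
      have hl : ((l : ℕ) : ℤ) + 1 ≤ L := by exact_mod_cast l.2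
      refine Finset.mem_image.2 ⟨(j + l).toNat, Finset.mem_range.2 ?_, ?_⟩
      · have : j + l < L * M := by linarith
        zify
        rw [Int.toNat_of_nonneg (by omega)]
        exact this
      · rw [Int.toNat_of_nonneg (by omega)]
        ring
    rw [Function.iterate_succ_apply']
    have hleft : refine M A ((refine M A)^[n] fun t => η t • v) t c =
        ∑ l : Fin L, ∑ c' : Fin p, ∑ j ∈ A.support, A j c c' * F (M * t - j - l) (l, c') := by
      simp only [refine, Finsupp.sum, Finset.sum_apply, Matrix.mulVec, dotProduct]
      rw [Finset.sum_comm]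
      simp only [ih, Finset.mul_sum]
      rw [Finset.sum_congr rfl fun c' _ => Finset.sum_comm, Finset.sum_comm]
    have hright : ∑ r : Fin L, cell (blockMatrix M L A)
        (fun x i => η x * if (i.1 : ℕ) = 0 then v i.2 else 0) (n + 1) (t - r) (r, c) =
        ∑ l : Fin L, ∑ c' : Fin p, ∑ r : Fin L, ∑ d : Fin M,
          A (d + M * r - l) c c' * F (M * (t - r) - d) (l, c') := by
      simp only [cell, Finset.sum_apply, Matrix.mulVec, dotProduct, blockMatrix,
        Fintype.sum_prod_type, ← hF]
      calc _ = ∑ r : Fin L, ∑ l : Fin L, ∑ c' : Fin p, ∑ d : Fin M,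
            A (d + M * r - l) c c' * F (M * (t - r) - d) (l, c') := by
            refine Finset.sum_congr rfl fun r _ => ?_
            rw [Finset.sum_comm]
            exact Finset.sum_congr rfl fun l _ => Finset.sum_comm
        _ = _ := by
            rw [Finset.sum_comm]
            exact Finset.sum_congr rfl fun l _ => Finset.sum_comm
    rw [hleft, hright]
    refine Finset.sum_congr rfl fun l _ => Finset.sum_congr rfl fun c' _ => ?_
    rw [hmask l (fun j => A j c c' * F (M * t - j - l) (l, c')) fun j hj => by simp [hj]]
    refine Finset.sum_congr rfl fun r _ => Finset.sum_congr rfl fun d _ => ?_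
    congr 2
    push_cast
    ring

end Refine

/-! ### Networks for the iterates of the refinement operator -/

lemma hat_sub (a b c θ x : ℝ) : hat (a - θ) (b - θ) (c - θ) (x - θ) = hat a b c x := by
  simp [hat]

/-- The width that suffices for one coordinate of the refinements of one hat on one unit interval;
the state vector has dimension `ν = L p`. -/
def cellWidth (M ν : ℕ) : ℕ := (2 * ν + 1) * (6 * M) + 32 * ν

lemma exists_comp_iterate_refine {M p L m : ℕ} (hM : 2 ≤ M) (hL : 1 ≤ L)
    {A : ℤ →₀ Matrix (Fin p) (Fin p) ℝ} (hA : PreservesWindow M L A) {γ : ℝ → Fin p → ℝ}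
    (hγ : Continuous γ) (hsupp : tsupport γ ⊆ Icc 0 (L : ℝ)) (hm : (breakpoints γ).encard ≤ m) :
    ∃ C Λ : ℝ, 1 ≤ C ∧ 1 ≤ Λ ∧ ∀ n c,
      Comp {id} ((m + 4 * L) * (L * cellWidth M (L * p))) (2 * n + 5) (C * Λ ^ n) C
        fun t => (refine M A)^[n] γ t c := by
  obtain ⟨k, hk, s, v, hs, hsb, hsum⟩ := exists_eq_sum_hat hL hγ hsupp hm
  have hL1 : (1 : ℝ) ≤ L := by exact_mod_cast hL
  have hM1 : (1 : ℝ) ≤ M := by exact_mod_cast (by omega : 1 ≤ M)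
  -- the `i`-th hat is moved by `θ i` into the interval `[1 / 4, 3 / 4]`
  set θ : ℕ → ℝ := fun i => s i - 1 / 4 with hθ
  set w : ℕ → Fin L × Fin p → ℝ := fun i j => if (j.1 : ℕ) = 0 then v i j.2 else 0 with hw
  have hlt : ∀ i, s i < s (i + 1) := fun i => hs (Nat.lt_succ_self i)
  have hex : ∀ i < k, ∃ C Λ : ℝ, 1 ≤ C ∧ 1 ≤ Λ ∧ ∀ n, ∀ τ, |τ| ≤ 2 * (L : ℝ) → ∀ j,
      Comp {id} (cellWidth M (L * p)) (2 * n + 5) (C * Λ ^ n) C fun t =>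
        cell (blockMatrix M L A)
          (fun x j => hat (s i - θ i) (s (i + 1) - θ i) (s (i + 2) - θ i) x * w i j) n
            (t - τ) j := by
    intro i hi
    have h := exists_comp_cell (by omega) (blockMatrix M L A) (w i)
      (a := s i - θ i) (b := s (i + 1) - θ i) (c := s (i + 2) - θ i) (by simp [hθ])
      (by linarith [hlt i]) (by linarith [hlt (i + 1)]) (by
        have := (hsb i hi).2.2
        simp only [hθ]
        linarith) (2 * L) (by positivity)
    simpa [cellWidth] using h
  choose! C Λ hC hΛ hcomp using hex
  have hC0 : ∀ i ∈ Finset.range k, 0 ≤ C i := fun i hi => by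
    linarith [hC i (Finset.mem_range.1 hi)]
  have hΛ0 : ∀ i ∈ Finset.range k, 0 ≤ Λ i := fun i hi => by
    linarith [hΛ i (Finset.mem_range.1 hi)]
  set C' : ℝ := 1 + ∑ i ∈ Finset.range k, C i with hC'
  set Λ' : ℝ := 1 + ∑ i ∈ Finset.range k, Λ i with hΛ'
  have hC'1 : 1 ≤ C' := le_add_of_nonneg_right (Finset.sum_nonneg hC0)
  have hΛ'1 : 1 ≤ Λ' := le_add_of_nonneg_right (Finset.sum_nonneg hΛ0)
  have hCle : ∀ i ∈ Finset.range k, C i ≤ C' := fun i hi =>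
    (Finset.single_le_sum hC0 hi).trans (le_add_of_nonneg_left zero_le_one)
  have hΛle : ∀ i ∈ Finset.range k, Λ i ≤ Λ' := fun i hi =>
    (Finset.single_le_sum hΛ0 hi).trans (le_add_of_nonneg_left zero_le_one)
  have hkL : 0 ≤ (k : ℝ) * (L * C') := by positivity
  refine ⟨C' + k * (L * C'), Λ', by linarith, hΛ'1, fun n c => ?_⟩
  have hMn : 1 ≤ (M : ℝ) ^ n := one_le_pow₀ hM1
  have hformula : (fun t => (refine M A)^[n] γ t c) = fun t => ∑ i ∈ Finset.range k,
      ∑ r : Fin L, cell (blockMatrix M L A)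
        (fun x j => hat (s i - θ i) (s (i + 1) - θ i) (s (i + 2) - θ i) x * w i j) n
          (t - (θ i / M ^ n + r)) (r, c) := by
    funext t
    rw [show γ = fun t => ∑ i ∈ Finset.range k, hat (s i) (s (i + 1)) (s (i + 2)) t • v i from
      funext hsum, iterate_refine_sum]
    beta_reduce
    rw [Finset.sum_apply]
    refine Finset.sum_congr rfl fun i _ => ?_
    have h1 := congrFun (congrFun (iterate_refine_comp_sub (A := A)
      (fun t => hat (s i - θ i) (s (i + 1) - θ i) (s (i + 2) - θ i) t • v i)
      (by omega : M ≠ 0) (θ i) n) t) c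
    simp only [hat_sub] at h1
    rw [h1, iterate_refine_eq_sum_cell (by omega) (fun j hj => hA.mask_eq_zero hM hL j hj)]
    simp only [sub_sub, hw]
  rw [hformula]
  have hcomp' : ∀ i ∈ Finset.range k, Comp {id} (L * cellWidth M (L * p)) (2 * n + 5)
      (C' * Λ' ^ n) (L * C') fun t => ∑ r : Fin L, cell (blockMatrix M L A)
        (fun x j => hat (s i - θ i) (s (i + 1) - θ i) (s (i + 2) - θ i) x * w i j) n
          (t - (θ i / M ^ n + r)) (r, c) := by
    intro i hi
    have h := Comp.sum Finset.univ fun (r : Fin L) _ => (hcomp i (Finset.mem_range.1 hi) n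
      (θ i / M ^ n + r) (by
        obtain ⟨h1, h2, -⟩ := hsb i (Finset.mem_range.1 hi)
        have hr : ((r : ℕ) : ℝ) + 1 ≤ L := by exact_mod_cast r.2
        have hr0 : (0 : ℝ) ≤ (r : ℕ) := Nat.cast_nonneg _
        have h3 : |θ i / (M : ℝ) ^ n| ≤ L := by
          rw [abs_div, abs_of_pos (by positivity : (0 : ℝ) < M ^ n)]
          refine (div_le_self (abs_nonneg _) hMn).trans (abs_le.2 ?_)
          simp only [hθ]
          constructor <;> linarith
        refine (abs_add_le _ _).trans ?_
        rw [abs_of_nonneg hr0]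
        linarith) (r, c)).mono le_rfl
      (mul_le_mul (hCle i hi) (pow_le_pow_left₀ (hΛ0 i hi) (hΛle i hi) n)
        (pow_nonneg (hΛ0 i hi) n) (by linarith)) (hCle i hi)
    simpa using h
  have h := Comp.sum (Finset.range k) hcomp'
  rw [Finset.card_range] at h
  refine h.mono (Nat.mul_le_mul_right _ hk) ?_ (by linarith)
  exact mul_le_mul_of_nonneg_right (by linarith) (by positivity)

theorem theorem1p1 (M p L m : ℕ) (hM : 2 ≤ M) (hp : 1 ≤ p) (hL : 1 ≤ L) :
    ∃ C₀ C₁ : ℕ, 0 < C₀ ∧ 0 < C₁ ∧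
      ∀ A : ℤ →₀ Matrix (Fin p) (Fin p) ℝ, PreservesWindow M L A →
      ∀ γ : ℝ → Fin p → ℝ, IsCPwL γ → HasCompactSupport γ → tsupport γ ⊆ Icc 0 (L : ℝ) →
        (breakpoints γ).encard ≤ m →
        ∃ C₂ Λ : ℝ, 0 < C₂ ∧ 0 < Λ ∧
          ∀ n : ℕ, 1 ≤ n →
            ∃ net : ReLUNet C₀ p 1 (C₁ * n),
              net.BoundedBy (C₂ * Λ ^ n) ∧
              ∀ t : ℝ, net.realize (fun _ => t) = ((refine M A)^[n] γ) t := by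
  classical
  refine ⟨p * ((m + 4 * L) * (L * cellWidth M (L * p))), 7, ?_, by norm_num, ?_⟩
  · have : 0 < cellWidth M (L * p) := by unfold cellWidth; positivity
    positivity
  intro A hA γ hγ _ hsupp hm
  obtain ⟨C, Λ, hC, hΛ, hcomp⟩ := exists_comp_iterate_refine hM hL hA hγ.continuous hsupp hm
  refine ⟨C, Λ, by linarith, by linarith, fun n hn => ?_⟩
  have hΛn : 1 ≤ Λ ^ n := one_le_pow₀ hΛ
  have hCΛ : C ≤ C * Λ ^ n := le_mul_of_one_le_right (by linarith) hΛn
  set V : Finset (ℝ → ℝ) := Finset.univ.image fun c t => (refine M A)^[n] γ t c with hV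
  have hVcard : V.card ≤ p := Finset.card_image_le.trans (by simp)
  have h1 : CompAll {id} (p * ((m + 4 * L) * (L * cellWidth M (L * p)))) (2 * n + 4 + 1)
      (C * Λ ^ n) (C * Λ ^ n) V := by
    refine (CompAll.of_comp (by omega) fun u hu => ?_).mono (Nat.mul_le_mul_right _ hVcard) le_rfl
      hCΛ
    obtain ⟨c, -, rfl⟩ := Finset.mem_image.1 hu
    exact hcomp n c
  -- the evaluation needs `2 n + 5` layers; identity layers make up the rest of `7 n`
  have h2 := h1.pad (by linarith) (5 * (n - 1))
  rw [show 2 * n + 4 + 5 * (n - 1) + 1 = 7 * n by omega] at h2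
  exact exists_net_of_comp (f := fun c t => (refine M A)^[n] γ t c) (by omega) h2
    (fun c => Finset.mem_image_of_mem _ (Finset.mem_univ c)) (by linarith)
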